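/- Let $\mathcal F=\bigoplus_{n\ge 0} L^2_{\rm sym}((\mathbb R^3)^n)$ be the bosonic Fock space over $L^2(\mathbb R^3)$, let $a(k),a^*(k)$ be the annihilation and creation operators and let $H_f=\int |k|\,a^*(k)a(k)\,dk$, i.e. multiplication by $|k_1|+\dots+|k_n|$ in the $n$-particle sector. Let $B_1=\{k\in\mathbb R^3: |k|\le 1\}$, and let $\chi_1:\mathbb R\to[0,1]$ be a smooth function with $\chi_1(r)=1$ for $r\le 9/10$ and $\chi_1(r)=0$ for $r\ge 1$; write $\chi_1$ also for $\chi_1(H_f)$. Fix $\mu\ge 0$, an integer $s\ge 1$ and $0<\xi<1$. Let $\mathcal W^{\mu,s}_\xi$ be the space of sequences $\underline w=(w_{m,n})_{m,n\ge 0}$ of the following kind. The function $w_{0,0}:[0,\infty)\to\mathbb C$ is $C^s$ with $\|w_{0,0}\|_{s}:=|w_{0,0}(0)|+\sum_{1\le\nu\le s}\sup_{r\ge 0}|\partial_r^\nu w_{0,0}(r)|<\infty$. For $m+n\ge 1$ the function $w_{m,n}:[0,1]\times B_1^{m+n}\to\mathbb C$ is measurable in the momenta $k=(k_1,\dots,k_m,\tilde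 k_1,\dots,\tilde k_n)$, is $C^s$ in $r\in[0,1]$ for almost every $k$, and is symmetric in $k_1,\dots,k_m$ and in $\tilde k_1,\dots,\tilde k_n$. With $$\|w_{m,n}\|_{\mu,s}:=\sum_{\nu=0}^s\ \max_j\ \operatorname*{sup}_{r\in[0,1]}\ \operatorname*{ess\,sup}_{k\in B_1^{m+n}}\ |k_j|^{-\mu}\,|\partial_r^\nu w_{m,n}[r;k]|$$ (where $k_j$ runs through all $m+n$ momentum variables), it is required that $\|\underline w_1\|_{\mu,s,\xi}:=\sum_{m+n\ge 1}\xi^{-(m+n)}\|w_{m,n}\|_{\mu,s}<\infty$. For $\underline w\in\mathcal W^{\mu,s}_\xi$ define $$H(\underline w):=w_{0,0}(H_f)+W(\underline w),\qquad W(\underline w):=\sum_{m+n\ge 1}\chi_1 W_{m,n}[w_{m,n}]\chi_1,$$ $$W_{m,n}[w_{m,n}]:=\int_{B_1^{m+n}}\prod_{i=1}^m\frac{dk_i}{|k_i|^{1/2}}\prod_{i=1}^n\frac{d\tilde k_i}{|\tilde k_i|^{1/2}}\ \prod_{i=1}^m a^*(k_i)\ w_{m,n}[H_f;k]\ \prod_{i=1}^n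 a(\tilde k_i),$$ the integral being understood weakly; the operators $\chi_1W_{m,n}[w_{m,n}]\chi_1$ are bounded and the series converges in operator norm. For real $\alpha,\beta,\gamma$ let $\mathcal D^{\mu,s}(\alpha,\beta,\gamma)$ be the set of operators $H(\underline w)$ with $\underline w\in\mathcal W^{\mu,s}_\xi$, $|w_{0,0}(0)|\le\alpha$, $\sup_{r\ge 0}|w_{0,0}'(r)-1|\le\beta$ and $\|\underline w_1\|_{\mu,s,\xi}\le\gamma$. A closed operator $A$ on $\mathcal F$ is called $H_f$-bounded if $A(H_f+1)^{-1}$ is bounded, and the $H_f$-bounded operators are normed by $\|A(H_f+1)^{-1}\|$. A map $f$ from an open subset $S$ of a complex Banach space $\mathcal B$ into a complex normed space is called analytic if for all $\lambda\in S$ and $\zeta\in\mathcal B$ the function $\tau\mapsto f(\lambda+\tau\zeta)$ is analytic in the complex variable $\tau$ near $0$. **Proposition.** Let $S$ be an open set in a complex Banach space, and let $\underline w^\lambda\in\mathcal W^{\mu,s}_\xi$ for $\lambda\in S$. Suppose that $\lambda\mapsto H(\underline w^\lambda)$ is analytic on $S$ as a map into the $H_f$-bounded operators and that, for some $\alpha,\beta,\gamma$,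 $H(\underline w^\lambda)\in\mathcal D^{\mu,s}(\alpha,\beta,\gamma)$ for all $\lambda\in S$. Then $$\lambda\mapsto w^\lambda_{0,0}(H_f)\qquad\text{and}\qquad \lambda\mapsto W(\underline w^\lambda)$$ are analytic on $S$ as maps into the $H_f$-bounded operators; moreover $\lambda\mapsto W(\underline w^\lambda)$ is analytic on $S$ as a map into the bounded operators $\mathcal B(\mathcal F)$ with the operator norm. -/

import Mathlib

open MeasureTheory Set

noncomputable section

namespace SpectralRG

/-- Momentum space `ℝ³` with its Euclidean norm and Lebesgue measure. -/
abbrev E3 : Type := EuclideanSpace ℝ (Fin 3)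

/-- The closed unit ball `B₁ ⊆ ℝ³`, to the power `m`. -/
def ballPow (m : ℕ) : Set (Fin m → E3) := {k | ∀ i, ‖k i‖ ≤ 1}

/-- The energy `|k₁| + … + |kₙ|` of `n` particles. -/
def energy {n : ℕ} (k : Fin n → E3) : ℝ := ∑ i, ‖k i‖

/-- Permutation of the `n` arguments of an `n`-particle function. -/
def permute {n : ℕ} (σ : Equiv.Perm (Fin n)) (k : Fin n → E3) : Fin n → E3 := fun i => k (σ i)

theorem measurePreserving_permute {n : ℕ} (σ : Equiv.Perm (Fin n)) :
    MeasurePreserving (permute σ) volume volume := by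
  have h := volume_measurePreserving_piCongrLeft (fun _ : Fin n => E3) σ.symm
  convert h using 1
  funext k i
  have := MeasurableEquiv.piCongrLeft_apply_apply (β := fun _ : Fin n => E3) (e := σ.symm)
    (x := k) (i := σ i)
  simpa [permute] using this.symm

/-- The totally symmetric `n`-particle wave functions in `L²((ℝ³)ⁿ)`.  For `n = 0` the underlying
space is a point of mass one, so that this is `ℂ`. -/
def symL2 (n : ℕ) : Submodule ℂ (Lp ℂ 2 (volume : Measure (Fin n → E3))) where
  carrier := {f | ∀ σ : Equiv.Perm (Fin n),
    Lp.compMeasurePreservingₗᵢ ℂ (permute σ) (measurePreserving_permute σ) f = f}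
  zero_mem' := fun σ => map_zero _
  add_mem' := fun hf hg σ => by rw [map_add, hf σ, hg σ]
  smul_mem' := fun c f hf σ => by rw [map_smul, hf σ]

/-- The bosonic Fock space over `L²(ℝ³)`: the Hilbert sum of the spaces of symmetric
`n`-particle wave functions. -/
abbrev Fock : Type := lp (fun n : ℕ => symL2 n) 2

/-- The `n`-particle wave function `ψₙ` of a vector of Fock space (a representative). -/
def wave (ψ : Fock) (n : ℕ) : (Fin n → E3) → ℂ := ((ψ : ∀ n, symL2 n) n).1

theorem wave_add (ψ φ : Fock) (n : ℕ) : wave (ψ + φ) n =ᵐ[volume] wave ψ n + wave φ n :=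
  Lp.coeFn_add _ _

theorem wave_smul (c : ℂ) (ψ : Fock) (n : ℕ) : wave (c • ψ) n =ᵐ[volume] c • wave ψ n :=
  Lp.coeFn_smul _ _

theorem wave_ext {ψ φ : Fock} (h : ∀ n, wave ψ n =ᵐ[volume] wave φ n) : ψ = φ :=
  lp.ext (funext fun n => Subtype.ext (Lp.ext (h n)))

/-- `η = f(H_f) ψ`: since `H_f` is multiplication by `|k₁| + … + |kₙ|` in the `n`-particle sector,
`f(H_f)` is multiplication by `f (|k₁| + … + |kₙ|)` there. -/
def IsFieldFun (f : ℝ → ℂ) (ψ η : Fock) : Prop :=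
  ∀ n, wave η n =ᵐ[volume] fun k => f (energy k) * wave ψ n k

theorem IsFieldFun.add {f : ℝ → ℂ} {ψ η ψ' η' : Fock} (h : IsFieldFun f ψ η)
    (h' : IsFieldFun f ψ' η') : IsFieldFun f (ψ + ψ') (η + η') := fun n => by
  filter_upwards [h n, h' n, wave_add ψ ψ' n, wave_add η η' n] with k h1 h2 h3 h4
  rw [h3, h4, Pi.add_apply, Pi.add_apply, h1, h2, mul_add]

theorem IsFieldFun.smul {f : ℝ → ℂ} {ψ η : Fock} (c : ℂ) (h : IsFieldFun f ψ η) :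
    IsFieldFun f (c • ψ) (c • η) := fun n => by
  filter_upwards [h n, wave_smul c ψ n, wave_smul c η n] with k h1 h3 h4
  rw [h3, h4, Pi.smul_apply, Pi.smul_apply, h1, smul_eq_mul, smul_eq_mul]
  ring

theorem IsFieldFun.unique {f : ℝ → ℂ} {ψ η η' : Fock} (h : IsFieldFun f ψ η)
    (h' : IsFieldFun f ψ η') : η = η' :=
  wave_ext fun n => (h n).trans (h' n).symm

/-- The operator `f(H_f)` of the functional calculus, on its maximal domain
`{ψ | f(H_f) ψ ∈ Fock}`. -/
def fieldFun (f : ℝ → ℂ) : Fock →ₗ.[ℂ] Fock where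
  domain :=
    { carrier := {ψ | ∃ η, IsFieldFun f ψ η}
      zero_mem' := ⟨0, by simpa using
        (show IsFieldFun f ((0 : ℂ) • (0 : Fock)) ((0 : ℂ) • (0 : Fock)) from fun n => by
          filter_upwards [wave_smul 0 0 n] with k h
          rw [h]; simp)⟩
      add_mem' := fun ⟨η, h⟩ ⟨η', h'⟩ => ⟨η + η', h.add h'⟩
      smul_mem' := fun c _ ⟨η, h⟩ => ⟨c • η, h.smul c⟩ }
  toFun :=
    { toFun := fun ψ => ψ.2.choose
      map_add' := fun ψ φ => (ψ + φ).2.choose_spec.unique (ψ.2.choose_spec.add φ.2.choose_spec)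
      map_smul' := fun c ψ => (c • ψ).2.choose_spec.unique (ψ.2.choose_spec.smul c) }

/-- The free field Hamiltonian `H_f`. -/
def fieldHamiltonian : Fock →ₗ.[ℂ] Fock := fieldFun (fun r => (r : ℂ))

/-! ### Analyticity -/

/-- Analyticity of `f : X → Y` on an (open) set `S`: for all `x ∈ S` and `v`, the map
`τ ↦ f (x + τ v)` is analytic for complex `τ` near `0`. -/
def LineAnalyticOn {X Y : Type*} [NormedAddCommGroup X] [NormedSpace ℂ X]
    [NormedAddCommGroup Y] [NormedSpace ℂ Y] (f : X → Y) (S : Set X) : Prop :=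
  ∀ x ∈ S, ∀ v : X, AnalyticAt ℂ (fun τ : ℂ => f (x + τ • v)) 0

/-- The closed operator `A` is `H_f`-bounded, and `A (H_f + 1)⁻¹` is the bounded operator `B`.
(As `H_f + 1` maps the domain of `H_f` onto Fock space, this determines `B`.) -/
def IsFieldBounded (A : Fock →ₗ.[ℂ] Fock) (B : Fock →L[ℂ] Fock) : Prop :=
  A.IsClosed ∧ ∀ ψ : fieldHamiltonian.domain, ∃ h : (ψ : Fock) ∈ A.domain,
    A ⟨ψ, h⟩ = B (fieldHamiltonian ψ + (ψ : Fock))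

/-- Analyticity of a map into the `H_f`-bounded operators, which are normed by
`A ↦ ‖A (H_f + 1)⁻¹‖`. -/
def FieldAnalyticOn {X : Type*} [NormedAddCommGroup X] [NormedSpace ℂ X]
    (A : X → Fock →ₗ.[ℂ] Fock) (S : Set X) : Prop :=
  ∃ B : X → Fock →L[ℂ] Fock, (∀ x ∈ S, IsFieldBounded (A x) (B x)) ∧ LineAnalyticOn B S

/-! ### Coupling functions and their norms -/

/-- Sequences `w = (w_{m,n})` of coupling functions `w_{m,n}[r; k₁,…,k_m, k̃₁,…,k̃_n]`.
Only the values at `0 ≤ r ≤ 1` and at momenta in the unit ball matter if `m + n ≥ 1`, and only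
those at `0 ≤ r` matter if `m = n = 0`. -/
abbrev Coupling : Type := ∀ m n : ℕ, ℝ → (Fin m → E3) → (Fin n → E3) → ℂ

/-- The function `w_{0,0}` of `r ∈ [0,∞)`. -/
def w00 (w : Coupling) (r : ℝ) : ℂ := w 0 0 r Fin.elim0 Fin.elim0

/-- The pairs `(m, n)` with `m + n ≥ 1`. -/
abbrev PosPair : Type := {p : ℕ × ℕ // 1 ≤ p.1 + p.2}

/-- Lebesgue measure on `B₁^m × B₁^n`. -/
def ballMeasure (m n : ℕ) : Measure ((Fin m → E3) × (Fin n → E3)) :=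
  volume.restrict (ballPow m ×ˢ ballPow n)

/-- `‖∂_r^ν v‖_μ`, that is the supremum over `r ∈ [0,1]`, over (almost all) momenta in the unit
ball and over all momentum variables `k_j` of `|k_j|^{-μ} |∂_r^ν v[r; k]|`. -/
def derivNorm (μ : ℝ) (ν : ℕ) {m n : ℕ} (v : ℝ → (Fin m → E3) → (Fin n → E3) → ℂ) : ENNReal :=
  essSup (fun k : (Fin m → E3) × (Fin n → E3) =>
    ⨆ j : Fin m ⊕ Fin n, ⨆ r ∈ Icc (0 : ℝ) 1,
      ‖iteratedDerivWithin ν (fun r => v r k.1 k.2) (Icc 0 1) r‖ₑ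
        / ‖Sum.elim k.1 k.2 j‖ₑ ^ μ) (ballMeasure m n)

/-- `‖w_{m,n}‖_{μ,s}` for `m + n ≥ 1`. -/
def couplingNorm (μ : ℝ) (s : ℕ) {m n : ℕ} (v : ℝ → (Fin m → E3) → (Fin n → E3) → ℂ) : ENNReal :=
  ∑ ν ∈ Finset.range (s + 1), derivNorm μ ν v

/-- `‖w_{0,0}‖_{μ,s}`, which does not depend on `μ`. -/
def couplingNorm00 (s : ℕ) (f : ℝ → ℂ) : ENNReal :=
  ‖f 0‖ₑ + ∑ ν ∈ Finset.Icc 1 s, ⨆ r ∈ Ici (0 : ℝ), ‖iteratedDerivWithin ν f (Ici 0) r‖ₑ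

/-- `‖w₁‖_{μ,s,ξ} = ∑_{m+n ≥ 1} ξ^{-(m+n)} ‖w_{m,n}‖_{μ,s}`. -/
def interactionNorm (μ : ℝ) (s : ℕ) (ξ : ℝ) (w : Coupling) : ENNReal :=
  ∑' p : PosPair, ENNReal.ofReal (ξ ^ (p.1.1 + p.1.2))⁻¹ * couplingNorm μ s (w p.1.1 p.1.2)

/-- Regularity and symmetry of `w_{m,n}` for `m + n ≥ 1`. -/
structure IsCouplingFun (s : ℕ) {m n : ℕ} (v : ℝ → (Fin m → E3) → (Fin n → E3) → ℂ) : Prop where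
  measurable : ∀ r ∈ Icc (0 : ℝ) 1,
    AEStronglyMeasurable (fun k : (Fin m → E3) × (Fin n → E3) => v r k.1 k.2) (ballMeasure m n)
  contDiffOn : ∀ᵐ k ∂(ballMeasure m n), ContDiffOn ℝ s (fun r => v r k.1 k.2) (Icc 0 1)
  symmetric : ∀ (σ : Equiv.Perm (Fin m)) (τ : Equiv.Perm (Fin n)),
    ∀ᵐ k ∂(ballMeasure m n), ∀ r ∈ Icc (0 : ℝ) 1,
      v r (permute σ k.1) (permute τ k.2) = v r k.1 k.2

/-- The space `𝒲^{μ,s}_ξ` of sequences of coupling functions. -/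
def couplingSpace (μ : ℝ) (s : ℕ) (ξ : ℝ) : Set Coupling :=
  {w | ContDiffOn ℝ s (w00 w) (Ici 0) ∧ (∀ p : PosPair, IsCouplingFun s (w p.1.1 p.1.2)) ∧
    couplingNorm00 s (w00 w) + interactionNorm μ s ξ w < ⊤}

/-! ### Wick monomials and Hamiltonians -/

/-- The cut-off function `χ₁`. -/
structure IsCutoff (χ : ℝ → ℝ) : Prop where
  smooth : ContDiff ℝ (⊤ : ℕ∞) χ
  eq_one : ∀ r ≤ 9 / 10, χ r = 1
  eq_zero : ∀ r ≥ 1, χ r = 0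
  mem_Icc : ∀ r, χ r ∈ Icc (0 : ℝ) 1

/-- The `l`-particle wave function at `q` of `a(k₁)⋯a(k_m) χ₁(H_f) ψ`, where
`(a(k)ψ)_l(q) = √(l+1) ψ_{l+1}(k, q)`. -/
def annihilateCut (χ : ℝ → ℝ) (ψ : Fock) {m l : ℕ} (k : Fin m → E3) (q : Fin l → E3) : ℂ :=
  (Real.sqrt ((m + l).factorial / l.factorial) : ℂ)
    * ((χ (energy (Fin.append k q)) : ℂ) * wave ψ (m + l) (Fin.append k q))

/-- The sesquilinear form of `χ₁ W_{m,n}[v] χ₁`, with `W_{m,n}[v]` understood as a weak integral: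
`∫ dk dk̃ |k|^{-1/2} |k̃|^{-1/2} ⟨a(k) χ₁ φ, v[H_f; k, k̃] a(k̃) χ₁ ψ⟩` over `B₁^m × B₁^n`. -/
def wickForm (χ : ℝ → ℝ) {m n : ℕ} (v : ℝ → (Fin m → E3) → (Fin n → E3) → ℂ) (φ ψ : Fock) : ℂ :=
  ∑' l : ℕ, ∫ x : ((Fin m → E3) × (Fin n → E3)) × (Fin l → E3),
    (((∏ i, ‖x.1.1 i‖) * ∏ i, ‖x.1.2 i‖) ^ (-(1 / 2) : ℝ) : ℝ)
      * (star (annihilateCut χ φ x.1.1 x.2)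
        * (v (energy x.2) x.1.1 x.1.2 * annihilateCut χ ψ x.1.2 x.2))
    ∂((ballMeasure m n).prod volume)

open Classical in
/-- The bounded operator `χ₁ W_{m,n}[v] χ₁`, i.e. the (unique) one with the form `wickForm χ v`.
It exists for all `v = w_{m,n}` with `w` in `couplingSpace`. -/
def wickOp (χ : ℝ → ℝ) {m n : ℕ} (v : ℝ → (Fin m → E3) → (Fin n → E3) → ℂ) : Fock →L[ℂ] Fock :=
  if h : ∃ A : Fock →L[ℂ] Fock, ∀ φ ψ, inner ℂ φ (A ψ) = wickForm χ v φ ψ then h.choose else 0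

/-- The interaction `W(w) = ∑_{m+n ≥ 1} χ₁ W_{m,n}[w_{m,n}] χ₁`, convergent in operator norm. -/
def interaction (χ : ℝ → ℝ) (w : Coupling) : Fock →L[ℂ] Fock :=
  ∑' p : PosPair, wickOp χ (w p.1.1 p.1.2)

/-- A bounded operator regarded as an unbounded operator with full domain. -/
def toUnbounded (A : Fock →L[ℂ] Fock) : Fock →ₗ.[ℂ] Fock := (A : Fock →ₗ[ℂ] Fock).toPMap ⊤

/-- `H(w) = w_{0,0}(H_f) + W(w)`, with the domain of `w_{0,0}(H_f)`. -/
def hamiltonian (χ : ℝ → ℝ) (w : Coupling) : Fock →ₗ.[ℂ] Fock :=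
  fieldFun (w00 w) + toUnbounded (interaction χ w)

/-- The polydisc `𝒟^{μ,s}(α,β,γ)` of operators `H(w) = E + T + W`, with `E = w_{0,0}(0)` and
`T = T(H_f)`, `T(r) = w_{0,0}(r) - w_{0,0}(0)`. -/
def polydisc (χ : ℝ → ℝ) (μ : ℝ) (s : ℕ) (ξ α β γ : ℝ) : Set (Fock →ₗ.[ℂ] Fock) :=
  hamiltonian χ '' {w | w ∈ couplingSpace μ s ξ ∧ ‖w00 w 0‖ ≤ α ∧
    (∀ r ∈ Ici (0 : ℝ), ‖derivWithin (fun r => w00 w r - w00 w 0) (Ici 0) r - 1‖ ≤ β) ∧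
    interactionNorm μ s ξ w ≤ ENNReal.ofReal γ}

end SpectralRG

end

open MeasureTheory Set

noncomputable section

namespace SpectralRG

/-! Write $B(\lambda)=H(\underline w^\lambda)(H_f+1)^{-1}$, an analytic family of bounded operators.
The point is to recover $w_{0,0}^\lambda$ from $B(\lambda)$ by analytic operations with errors
uniform in $\lambda$.

Let $f$ be the one-particle indicator of a ball of radius $\varepsilon$ and volume $V$ around
$k_0\ne 0$. Particle counting leaves only $m=n=1$ in $\langle f,Wf\rangle$. That term is an integral
over the product of two balls, hence $O(V^2)$, while $\langle f,f\rangle=V$. Since $w_{0,0}$ is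
Lipschitz, $\langle f,B(H_f+1)f\rangle/V$ tends to $w_{0,0}(|k_0|)$, with an error depending only on
$\beta,\gamma,|k_0|,\varepsilon$ (`norm_ballAverage_sub_le`). Uniform limits of holomorphic
functions are holomorphic, so $w_{0,0}^\lambda(r)$ is holomorphic for each $r>0$, and for $r=0$ by a
further uniform limit (`differentiableOn_w00_of_ballAverage`).

Pointwise holomorphy of $w_{0,0}^\lambda(r)/(1+r)$, together with the uniform sup bound
$\alpha+|1+\beta|$, gives analyticity in sup norm (`analyticAt_of_norming`). The functional calculus
`boundedFieldFun` is linear and continuous, so $w_{0,0}^\lambda(H_f)(H_f+1)^{-1}$ is analytic, and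
by subtraction so is $W(H_f+1)^{-1}$. Because of the cut-offs, $W=Wp(H_f)$ whenever $p=1$ on
$[0,1]$. With $p$ decaying like $1/r$, the operator $(H_f+1)p(H_f)$ is bounded, and composing with
it gives analyticity of $W$ in operator norm (`IsCouplingBound.interaction_eq`). -/

/-! ### Banach space valued holomorphy -/

open Filter Topology Complex in
/-- A locally bounded Banach space valued function is analytic if it becomes holomorphic under
every functional of a norming family. -/
theorem analyticAt_of_norming {Y ι : Type*} [NormedAddCommGroup Y] [NormedSpace ℂ Y]
    [CompleteSpace Y] (ℓ : ι → Y →L[ℂ] ℂ) (hle : ∀ i y, ‖ℓ i y‖ ≤ ‖y‖)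
    (hnorming : ∀ y C, 0 ≤ C → (∀ i, ‖ℓ i y‖ ≤ C) → ‖y‖ ≤ C)
    {U : Set ℂ} (hU : IsOpen U) {F : ℂ → Y} {M : ℝ} (hM : ∀ z ∈ U, ‖F z‖ ≤ M)
    (hF : ∀ i, DifferentiableOn ℂ (fun z => ℓ i (F z)) U) {c : ℂ} (hc : c ∈ U) :
    AnalyticAt ℂ F c := by
  have hcont : ContinuousOn F U := by
    intro z hz
    obtain ⟨R, hR, hRU⟩ := Metric.isOpen_iff.1 hU z hz
    have hM0 : 0 ≤ M := (norm_nonneg _).trans (hM z hz)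
    -- Schwarz lemma for each $\ell_i\circ F$: it maps the ball into a disc of radius at most $2M$
    -- around its value at $z$. The resulting constant does not depend on $i$.
    have hlip : ∀ w ∈ Metric.ball z R, ‖F w - F z‖ ≤ (2 * M + 1) / R * dist w z := by
      intro w hw
      refine hnorming _ _ (by positivity) fun i => ?_
      have := dist_le_div_mul_dist_of_mapsTo_ball (R₂ := 2 * M + 1) ((hF i).mono hRU)
        (fun y hy => ?_) hw
      · simpa [dist_eq_norm] using this
      · rw [mem_closedBall_iff_norm]
        have h1 := (hle i (F y)).trans (hM y (hRU hy))
        have h2 := (hle i (F z)).trans (hM z hz)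
        exact (norm_sub_le _ _).trans (by linarith)
    refine ContinuousAt.continuousWithinAt ?_
    rw [ContinuousAt, tendsto_iff_norm_sub_tendsto_zero]
    have hlim : Tendsto (fun w => (2 * M + 1) / R * dist w z) (𝓝 z) (𝓝 0) := by
      have : Continuous fun w => (2 * M + 1) / R * dist w z := by fun_prop
      simpa using this.tendsto z
    refine squeeze_zero' (Eventually.of_forall fun _ => norm_nonneg _) ?_ hlim
    filter_upwards [Metric.ball_mem_nhds z hR] with w hw using hlip w hw
  obtain ⟨R, hR, hRU⟩ := Metric.nhds_basis_closedBall.mem_iff.1 (hU.mem_nhds hc)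
  lift R to NNReal using hR.le
  have hsphere : ContinuousOn F (Metric.sphere c R) :=
    hcont.mono (Metric.sphere_subset_closedBall.trans hRU)
  -- The Cauchy integral of a continuous function is analytic. That it equals $F$ is tested on each
  -- $\ell_i$, where the scalar Cauchy formula applies.
  have hps := hasFPowerSeriesOn_cauchy_integral (hsphere.circleIntegrable R.2) (by exact_mod_cast hR)
  refine hps.analyticAt.congr ?_
  filter_upwards [Metric.ball_mem_nhds c hR] with w hw
  rw [← sub_eq_zero, ← norm_le_zero_iff]
  refine hnorming _ _ le_rfl fun i => ?_
  rw [map_sub, map_smul]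
  have hcts : ContinuousOn (fun z => (z - w)⁻¹ • F z) (Metric.sphere c R) := by
    refine ContinuousOn.smul (ContinuousOn.inv₀ (by fun_prop) fun z hz h => ?_) hsphere
    rw [sub_eq_zero] at h
    subst h
    exact (Metric.mem_ball.1 hw).ne (Metric.mem_sphere.1 hz)
  have hcomm : ℓ i (∮ z in C(c, R), (z - w)⁻¹ • F z) =
      ∮ z in C(c, R), (z - w)⁻¹ • ℓ i (F z) := by
    have h := (hcts.circleIntegrable R.2).out
    simp only [circleIntegral] at h ⊢
    have e := (ℓ i).intervalIntegral_comp_comm h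
    simp only [map_smul] at e
    exact e.symm
  rw [hcomm, two_pi_I_inv_smul_circleIntegral_sub_inv_smul_of_differentiable_on_off_countable
    countable_empty hw ((hF i).continuousOn.mono hRU) fun z hz =>
      (hF i).differentiableAt (hU.mem_nhds (hRU (Metric.ball_subset_closedBall hz.1)))]
  simp

/-! ### Functions of $H_f$ on Fock space -/

theorem continuous_energy {n : ℕ} : Continuous (energy : (Fin n → E3) → ℝ) := by
  unfold energy; fun_prop

theorem energy_nonneg {n : ℕ} (k : Fin n → E3) : 0 ≤ energy k :=
  Finset.sum_nonneg fun _ _ => norm_nonneg _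

theorem energy_permute {n : ℕ} (σ : Equiv.Perm (Fin n)) (k : Fin n → E3) :
    energy (permute σ k) = energy k :=
  Equiv.sum_comp σ fun i => ‖k i‖

theorem wave_permute (ψ : Fock) {n : ℕ} (σ : Equiv.Perm (Fin n)) :
    (fun k => wave ψ n (permute σ k)) =ᵐ[volume] wave ψ n := by
  have h := Lp.coeFn_compMeasurePreserving ((ψ : ∀ n, symL2 n) n).1 (measurePreserving_permute σ)
  exact h.symm.trans (Filter.EventuallyEq.of_eq (congrArg
    (fun f : Lp ℂ 2 volume => (f : (Fin n → E3) → ℂ)) (((ψ : ∀ n, symL2 n) n).2 σ)))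

/-- Multiplication of the `n`-particle wave function by a bounded continuous function of the
energy. -/
theorem exists_sector_mul (g : BoundedContinuousFunction ℝ ℂ) (ψ : Fock) (n : ℕ) :
    ∃ η : symL2 n, (η.1 =ᵐ[volume] fun k => g (energy k) * wave ψ n k) ∧
      ‖η‖ ≤ ‖g‖ * ‖(ψ : ∀ n, symL2 n) n‖ := by
  have hmem : MemLp (fun k => g (energy k) * wave ψ n k) 2 volume := by
    refine (Lp.memLp ((ψ : ∀ n, symL2 n) n).1).of_le_mul (c := ‖g‖)
      ((g.continuous.comp continuous_energy).aestronglyMeasurable.mul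
        (Lp.aestronglyMeasurable _)) (Filter.Eventually.of_forall fun k => ?_)
    rw [norm_mul]
    exact mul_le_mul_of_nonneg_right (g.norm_coe_le_norm _) (norm_nonneg _)
  refine ⟨⟨hmem.toLp, fun σ => ?_⟩, hmem.coeFn_toLp, ?_⟩
  · refine Lp.ext ?_
    have h1 := Lp.coeFn_compMeasurePreserving hmem.toLp (measurePreserving_permute σ)
    have h2 := (measurePreserving_permute σ).quasiMeasurePreserving.ae_eq_comp hmem.coeFn_toLp
    refine h1.trans (h2.trans ?_)
    filter_upwards [wave_permute ψ σ, hmem.coeFn_toLp] with k h3 h4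
    rw [h4, Function.comp_apply, energy_permute, h3]
  · refine Lp.norm_le_mul_norm_of_ae_le_mul (p := 2) (f := hmem.toLp) ?_
    filter_upwards [hmem.coeFn_toLp] with k hk
    rw [hk, norm_mul]
    exact mul_le_mul_of_nonneg_right (g.norm_coe_le_norm _) (norm_nonneg _)

theorem exists_isFieldFun (g : BoundedContinuousFunction ℝ ℂ) (ψ : Fock) :
    ∃ η, IsFieldFun g ψ η ∧ ‖η‖ ≤ ‖g‖ * ‖ψ‖ := by
  choose η hη hn using exists_sector_mul g ψ
  have hmem : Memℓp η 2 := by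
    have h := (lp.memℓp ψ).summable (p := 2) (by norm_num)
    refine memℓp_gen (Summable.of_nonneg_of_le (fun n => by positivity) (fun n => ?_)
      (h.mul_left (‖g‖ ^ (2 : ENNReal).toReal)))
    rw [← Real.mul_rpow (norm_nonneg _) (norm_nonneg _)]
    exact Real.rpow_le_rpow (norm_nonneg _) (hn n) (by norm_num)
  refine ⟨⟨η, hmem⟩, hη, ?_⟩
  refine lp.norm_le_of_forall_sum_le (by norm_num) (by positivity) fun t => ?_
  rw [Real.mul_rpow (norm_nonneg _) (norm_nonneg _)]
  refine le_trans ?_ (mul_le_mul_of_nonneg_left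
    (lp.sum_rpow_le_norm_rpow (by norm_num) ψ t) (by positivity))
  rw [Finset.mul_sum]
  refine Finset.sum_le_sum fun n _ => ?_
  rw [← Real.mul_rpow (norm_nonneg _) (norm_nonneg _)]
  exact Real.rpow_le_rpow (norm_nonneg _) (hn n) (by norm_num)

theorem IsFieldFun.congr {f g : ℝ → ℂ} {ψ η : Fock} (h : IsFieldFun f ψ η)
    (hfg : ∀ r, 0 ≤ r → f r = g r) : IsFieldFun g ψ η := fun n => by
  filter_upwards [h n] with k hk
  rw [hk, hfg _ (energy_nonneg k)]

theorem IsFieldFun.add_fun {f g : ℝ → ℂ} {ψ η η' : Fock} (h : IsFieldFun f ψ η)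
    (h' : IsFieldFun g ψ η') : IsFieldFun (f + g) ψ (η + η') := fun n => by
  filter_upwards [h n, h' n, wave_add η η' n] with k h1 h2 h3
  rw [h3, Pi.add_apply, h1, h2, Pi.add_apply, add_mul]

theorem IsFieldFun.smul_fun {f : ℝ → ℂ} {ψ η : Fock} (c : ℂ) (h : IsFieldFun f ψ η) :
    IsFieldFun (c • f) ψ (c • η) := fun n => by
  filter_upwards [h n, wave_smul c η n] with k h1 h2
  rw [h2, Pi.smul_apply, h1, Pi.smul_apply, smul_eq_mul, smul_eq_mul, mul_assoc]

theorem IsFieldFun.mul {f g : ℝ → ℂ} {ψ η ζ : Fock} (h : IsFieldFun f ψ η)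
    (h' : IsFieldFun g η ζ) : IsFieldFun (fun r => g r * f r) ψ ζ := fun n => by
  filter_upwards [h n, h' n] with k h1 h2
  rw [h2, h1, mul_assoc]

/-- The bounded operators `g(H_f)` for bounded continuous `g`. -/
def boundedFieldFun : BoundedContinuousFunction ℝ ℂ →L[ℂ] Fock →L[ℂ] Fock :=
  LinearMap.mkContinuous₂
    (LinearMap.mk₂ ℂ (fun g ψ => (exists_isFieldFun g ψ).choose)
      (fun g g' ψ => (exists_isFieldFun (g + g') ψ).choose_spec.1.unique
        ((exists_isFieldFun g ψ).choose_spec.1.add_fun (exists_isFieldFun g' ψ).choose_spec.1))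
      (fun c g ψ => (exists_isFieldFun (c • g) ψ).choose_spec.1.unique
        ((exists_isFieldFun g ψ).choose_spec.1.smul_fun c))
      (fun g ψ ψ' => (exists_isFieldFun g (ψ + ψ')).choose_spec.1.unique
        ((exists_isFieldFun g ψ).choose_spec.1.add (exists_isFieldFun g ψ').choose_spec.1))
      (fun c g ψ => (exists_isFieldFun g (c • ψ)).choose_spec.1.unique
        ((exists_isFieldFun g ψ).choose_spec.1.smul c)))
    1 fun g ψ => by
      rw [one_mul]; exact (exists_isFieldFun g ψ).choose_spec.2

theorem isFieldFun_boundedFieldFun (g : BoundedContinuousFunction ℝ ℂ) (ψ : Fock) :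
    IsFieldFun g ψ (boundedFieldFun g ψ) :=
  (exists_isFieldFun g ψ).choose_spec.1

theorem isFieldFun_fieldFun {f : ℝ → ℂ} (ψ : (fieldFun f).domain) :
    IsFieldFun f ψ (fieldFun f ψ) :=
  ψ.2.choose_spec

theorem fieldFun_eq {f : ℝ → ℂ} {ψ η : Fock} (h : IsFieldFun f ψ η)
    (hψ : ψ ∈ (fieldFun f).domain) : fieldFun f ⟨ψ, hψ⟩ = η :=
  (isFieldFun_fieldFun ⟨ψ, hψ⟩).unique h

theorem mem_graph_fieldFun {f : ℝ → ℂ} {x : Fock × Fock} :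
    x ∈ (fieldFun f).graph ↔ IsFieldFun f x.1 x.2 := by
  rw [LinearPMap.mem_graph_iff]
  constructor
  · rintro ⟨y, hy, hy'⟩
    rw [← hy, ← hy']
    exact isFieldFun_fieldFun y
  · exact fun h => ⟨⟨x.1, x.2, h⟩, rfl, fieldFun_eq h _⟩

open Filter Topology in
theorem exists_subseq_wave_tendsto {u : ℕ → Fock} {ψ : Fock} (h : Tendsto u atTop (𝓝 ψ)) (n : ℕ) :
    ∃ ns : ℕ → ℕ, StrictMono ns ∧
      ∀ᵐ k, Tendsto (fun i => wave (u (ns i)) n k) atTop (𝓝 (wave ψ n k)) := by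
  have h1 : Tendsto (fun i => ((u i : ∀ n, symL2 n) n).1) atTop (𝓝 ((ψ : ∀ n, symL2 n) n).1) := by
    rw [tendsto_iff_norm_sub_tendsto_zero] at h ⊢
    refine squeeze_zero (fun _ => norm_nonneg _) (fun i => ?_) h
    exact lp.norm_apply_le_norm (p := 2) (by norm_num) (u i - ψ) n
  exact (tendstoInMeasure_of_tendsto_Lp h1).exists_seq_tendsto_ae

-- Convergence in Fock space gives almost everywhere convergence in each sector along a subsequence,
-- and the pointwise relation defining $f(H_f)$ survives the limit. No regularity of $f$ enters.
open Filter Topology in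
theorem isClosed_fieldFun (f : ℝ → ℂ) : (fieldFun f).IsClosed := by
  refine IsSeqClosed.isClosed fun x p hx hp => ?_
  simp only [SetLike.mem_coe, mem_graph_fieldFun] at hx ⊢
  intro n
  obtain ⟨ns, hns, h1⟩ := exists_subseq_wave_tendsto ((continuous_fst.tendsto p).comp hp) n
  obtain ⟨ms, hms, h2⟩ := exists_subseq_wave_tendsto
    (((continuous_snd.tendsto p).comp hp).comp hns.tendsto_atTop) n
  have h3 : ∀ᵐ k, ∀ i, wave (x i).2 n k = f (energy k) * wave (x i).1 n k :=
    ae_all_iff.2 fun i => hx i n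
  filter_upwards [h1, h2, h3] with k h1 h2 h3
  refine tendsto_nhds_unique h2 ?_
  have := (h1.comp hms.tendsto_atTop).const_mul (f (energy k))
  refine this.congr fun i => ?_
  simp [h3]

theorem isClosed_toUnbounded (A : Fock →L[ℂ] Fock) : (toUnbounded A).IsClosed := by
  have : ((toUnbounded A).graph : Set (Fock × Fock)) = {x | A x.1 = x.2} := by
    ext x
    simp only [SetLike.mem_coe, LinearPMap.mem_graph_iff, Set.mem_ofPred_eq]
    constructor
    · rintro ⟨y, hy, hy'⟩
      rw [← hy, ← hy']
      rfl
    · exact fun h => ⟨⟨x.1, trivial⟩, rfl, h⟩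
  rw [LinearPMap.IsClosed, this]
  exact isClosed_eq (by fun_prop) (by fun_prop)

/-! ### Wick monomials and the energy cut-off -/

theorem measurePreserving_append (m l : ℕ) :
    MeasurePreserving (fun x : (Fin m → E3) × (Fin l → E3) => Fin.append x.1 x.2)
      (volume.prod volume) volume := by
  have h1 := volume_measurePreserving_sumPiEquivProdPi_symm (fun _ : Fin m ⊕ Fin l => E3)
  have h2 := volume_measurePreserving_piCongrLeft (fun _ : Fin (m + l) => E3)
    (finSumFinEquiv (m := m) (n := l))
  suffices h : (fun x : (Fin m → E3) × (Fin l → E3) => Fin.append x.1 x.2) =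
      MeasurableEquiv.piCongrLeft (fun _ : Fin (m + l) => E3) finSumFinEquiv ∘
        (MeasurableEquiv.sumPiEquivProdPi (fun _ : Fin m ⊕ Fin l => E3)).symm by
    rw [h]; exact h2.comp h1
  funext x i
  obtain ⟨j, rfl⟩ := finSumFinEquiv.surjective i
  have := MeasurableEquiv.piCongrLeft_apply_apply (β := fun _ : Fin (m + l) => E3)
    (e := finSumFinEquiv)
    (x := (MeasurableEquiv.sumPiEquivProdPi (fun _ : Fin m ⊕ Fin l => E3)).symm x) (i := j)
  rw [Function.comp_apply, this]
  cases j <;> simp [MeasurableEquiv.coe_sumPiEquivProdPi_symm, Equiv.sumPiEquivProdPi]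

theorem ballMeasure_prod_absolutelyContinuous (m n l : ℕ) :
    (ballMeasure m n).prod (volume : Measure (Fin l → E3)) ≪ (volume.prod volume).prod volume :=
  Measure.absolutelyContinuous_of_le (Measure.prod_mono Measure.restrict_le_self le_rfl)

/-- Wave functions are known only almost everywhere, and `wickForm` evaluates them at concatenated
momenta; null sets must therefore pull back to null sets under concatenation. -/
theorem ae_append_left {m n l : ℕ} {P : (Fin (m + l) → E3) → Prop} (h : ∀ᵐ k, P k) :
    ∀ᵐ x : ((Fin m → E3) × (Fin n → E3)) × (Fin l → E3) ∂((ballMeasure m n).prod volume),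
      P (Fin.append x.1.1 x.2) := by
  refine (ballMeasure_prod_absolutelyContinuous m n l).ae_le ?_
  have h1 : Measure.QuasiMeasurePreserving
      (Prod.map Prod.fst id : ((Fin m → E3) × (Fin n → E3)) × (Fin l → E3) → _)
      ((volume.prod volume).prod volume) (volume.prod volume) :=
    QuasiMeasurePreserving.prodMap Measure.quasiMeasurePreserving_fst (.id _)
  exact ((measurePreserving_append m l).quasiMeasurePreserving.comp h1).ae h

theorem ae_append_right {m n l : ℕ} {P : (Fin (n + l) → E3) → Prop} (h : ∀ᵐ k, P k) :
    ∀ᵐ x : ((Fin m → E3) × (Fin n → E3)) × (Fin l → E3) ∂((ballMeasure m n).prod volume),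
      P (Fin.append x.1.2 x.2) := by
  refine (ballMeasure_prod_absolutelyContinuous m n l).ae_le ?_
  have h1 : Measure.QuasiMeasurePreserving
      (Prod.map Prod.snd id : ((Fin m → E3) × (Fin n → E3)) × (Fin l → E3) → _)
      ((volume.prod volume).prod volume) (volume.prod volume) :=
    QuasiMeasurePreserving.prodMap Measure.quasiMeasurePreserving_snd (.id _)
  exact ((measurePreserving_append n l).quasiMeasurePreserving.comp h1).ae h

/-- The forms of the Wick monomials only see the part of a vector with energy at most one. -/
theorem wickForm_eq_of_isFieldFun {χ : ℝ → ℝ} (hχ : IsCutoff χ) {m n : ℕ}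
    (v : ℝ → (Fin m → E3) → (Fin n → E3) → ℂ) {p : ℝ → ℂ} (hp : ∀ r, 0 ≤ r → r ≤ 1 → p r = 1)
    (φ : Fock) {ψ η : Fock} (h : IsFieldFun p ψ η) : wickForm χ v φ η = wickForm χ v φ ψ := by
  unfold wickForm
  refine tsum_congr fun l => integral_congr_ae ?_
  filter_upwards [ae_append_right (m := m) (n := n) (h (n + l))] with x hx
  have : annihilateCut χ η x.1.2 x.2 = annihilateCut χ ψ x.1.2 x.2 := by
    unfold annihilateCut
    rw [hx]
    rcases le_total (energy (Fin.append x.1.2 x.2)) 1 with h1 | h1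
    · rw [hp _ (energy_nonneg _) h1, one_mul]
    · rw [hχ.eq_zero _ h1]; simp
  rw [this]

/-- Covers the default value of `wickOp`, so that existence of the bounded operator never has to be
proved: the zero operator satisfies every estimate below. -/
theorem inner_wickOp {χ : ℝ → ℝ} {m n : ℕ} (v : ℝ → (Fin m → E3) → (Fin n → E3) → ℂ) :
    wickOp χ v = 0 ∨ ∀ φ ψ, inner ℂ φ (wickOp χ v ψ) = wickForm χ v φ ψ := by
  unfold wickOp
  split_ifs with h
  · exact .inr h.choose_spec
  · exact .inl rfl

theorem wickOp_eq_of_isFieldFun {χ : ℝ → ℝ} (hχ : IsCutoff χ) {m n : ℕ}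
    (v : ℝ → (Fin m → E3) → (Fin n → E3) → ℂ) {p : ℝ → ℂ} (hp : ∀ r, 0 ≤ r → r ≤ 1 → p r = 1)
    {ψ η : Fock} (h : IsFieldFun p ψ η) : wickOp χ v η = wickOp χ v ψ := by
  rcases inner_wickOp (χ := χ) v with h0 | h0
  · rw [h0]; rfl
  · exact ext_inner_left ℂ fun φ => by rw [h0, h0, wickForm_eq_of_isFieldFun hχ v hp φ h]

theorem interaction_eq_of_isFieldFun {χ : ℝ → ℝ} (hχ : IsCutoff χ) (w : Coupling) {p : ℝ → ℂ}
    (hp : ∀ r, 0 ≤ r → r ≤ 1 → p r = 1) {ψ η : Fock} (h : IsFieldFun p ψ η) :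
    interaction χ w η = interaction χ w ψ := by
  unfold interaction
  by_cases hs : Summable fun q : PosPair => wickOp χ (w q.1.1 q.1.2)
  · have e : ∀ ψ : Fock, (∑' q : PosPair, wickOp χ (w q.1.1 q.1.2)) ψ =
        ∑' q : PosPair, wickOp χ (w q.1.1 q.1.2) ψ :=
      fun ψ => (ContinuousLinearMap.apply ℂ Fock ψ).map_tsum hs
    rw [e, e]
    exact tsum_congr fun q => wickOp_eq_of_isFieldFun hχ _ hp h
  · rw [tsum_eq_zero_of_not_summable hs]; rfl

/-! ### One-particle test vectors -/

/-- The indicator of a ball in one-particle momentum space. -/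
def ballIndicator (k₀ : E3) (ε : ℝ) : Lp ℂ 2 (volume : Measure (Fin 1 → E3)) :=
  indicatorConstLp 2 (measurableSet_ball (x := fun _ : Fin 1 => k₀) (ε := ε))
    measure_ball_lt_top.ne (1 : ℂ)

/-- The one-particle vector whose wave function is the indicator of the ball around `k₀` of
radius `ε`. -/
def ballVector (k₀ : E3) (ε : ℝ) : Fock :=
  lp.single 2 1 ⟨ballIndicator k₀ ε, fun σ => by
      have : permute σ = id := by
        funext k i; simp [permute, Subsingleton.elim σ 1]
      refine Lp.ext ((Lp.coeFn_compMeasurePreserving _ _).trans ?_)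
      rw [this]; rfl⟩

/-- The volume of a ball of radius `ε`. -/
def ballVolume (ε : ℝ) : ℝ := volume.real (Metric.ball (0 : Fin 1 → E3) ε)

theorem ballVolume_eq (k₀ : E3) (ε : ℝ) :
    volume.real (Metric.ball (fun _ : Fin 1 => k₀) ε) = ballVolume ε :=
  Measure.addHaar_real_ball_center _ _ _

theorem ballVolume_pos {ε : ℝ} (hε : 0 < ε) : 0 < ballVolume ε :=
  ENNReal.toReal_pos (Metric.measure_ball_pos _ _ hε).ne' measure_ball_lt_top.ne

open Filter Topology in
theorem tendsto_ballVolume : Tendsto ballVolume (𝓝[>] 0) (𝓝 0) := by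
  have h : ∀ ε : ℝ, 0 < ε → ballVolume ε = ε ^ Module.finrank ℝ (Fin 1 → E3) * ballVolume 1 := by
    intro ε hε
    unfold ballVolume Measure.real
    rw [Measure.addHaar_ball_of_pos _ _ hε, ENNReal.toReal_mul,
      ENNReal.toReal_ofReal (by positivity)]
  have hlim : Tendsto (fun ε : ℝ => ε ^ Module.finrank ℝ (Fin 1 → E3) * ballVolume 1)
      (𝓝[>] 0) (𝓝 0) := by
    have : Continuous fun ε : ℝ => ε ^ Module.finrank ℝ (Fin 1 → E3) * ballVolume 1 := by fun_prop
    refine (this.tendsto' 0 0 ?_).mono_left nhdsWithin_le_nhds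
    rw [zero_pow Module.finrank_pos.ne', zero_mul]
  refine hlim.congr' ?_
  filter_upwards [self_mem_nhdsWithin] with ε hε using (h ε hε).symm

theorem wave_ballVector_one (k₀ : E3) (ε : ℝ) :
    wave (ballVector k₀ ε) 1 =ᵐ[volume]
      (Metric.ball (fun _ : Fin 1 => k₀) ε).indicator fun _ => (1 : ℂ) := by
  have : wave (ballVector k₀ ε) 1 = ballIndicator k₀ ε := by
    unfold wave ballVector
    rw [lp.single_apply_self]
  rw [this]
  exact indicatorConstLp_coeFn

theorem wave_ballVector_of_ne (k₀ : E3) (ε : ℝ) {n : ℕ} (hn : n ≠ 1) (k : Fin n → E3) :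
    wave (ballVector k₀ ε) n k = 0 := by
  unfold wave ballVector
  rw [lp.single_apply_ne _ _ _ hn]
  -- The chosen representative of the zero class vanishes at every point, not just almost
  -- everywhere.
  exact AEEqFun.coeFn_const_eq (μ := volume) (b := (0 : ℂ)) (x := k)

theorem inner_ballVector (k₀ : E3) (ε : ℝ) (ψ : Fock) :
    inner ℂ (ballVector k₀ ε) ψ = ∫ k in Metric.ball (fun _ : Fin 1 => k₀) ε, wave ψ 1 k := by
  unfold ballVector
  rw [lp.inner_single_left]
  exact L2.inner_indicatorConstLp_one measurableSet_ball measure_ball_lt_top.ne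
    ((ψ : ∀ n, symL2 n) 1).1

theorem inner_ballVector_self (k₀ : E3) (ε : ℝ) :
    inner ℂ (ballVector k₀ ε) (ballVector k₀ ε) = (ballVolume ε : ℂ) := by
  rw [inner_ballVector, ← ballVolume_eq k₀]
  have : ∀ᵐ k, k ∈ Metric.ball (fun _ : Fin 1 => k₀) ε → wave (ballVector k₀ ε) 1 k = 1 := by
    filter_upwards [wave_ballVector_one k₀ ε] with k hk hmem
    rw [hk, indicator_of_mem hmem]
  rw [setIntegral_congr_ae measurableSet_ball this]
  simp

theorem energy_mem_of_mem_ball {k₀ : E3} {ε : ℝ} {k : Fin 1 → E3}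
    (hk : k ∈ Metric.ball (fun _ : Fin 1 => k₀) ε) : |energy k - ‖k₀‖| ≤ ε := by
  have h1 : energy k = ‖k 0‖ := by simp [energy]
  rw [h1]
  refine (abs_norm_sub_norm_le _ _).trans ?_
  rw [← dist_eq_norm]
  exact (dist_le_pi_dist k (fun _ => k₀) 0).trans (Metric.mem_ball.1 hk).le

/-! ### The interaction in a one-particle state -/

theorem annihilateCut_ballVector_of_ne (χ : ℝ → ℝ) (k₀ : E3) (ε : ℝ) {m l : ℕ} (h : m + l ≠ 1)
    (k : Fin m → E3) (q : Fin l → E3) : annihilateCut χ (ballVector k₀ ε) k q = 0 := by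
  unfold annihilateCut
  rw [wave_ballVector_of_ne k₀ ε h, mul_zero, mul_zero]

/-- Only the Wick monomial with `m = n = 1` has an expectation in a one-particle state. -/
theorem wickForm_ballVector_eq_zero (χ : ℝ → ℝ) (k₀ : E3) (ε : ℝ) {m n : ℕ} (hmn : 1 ≤ m + n)
    (hne : ¬ (m = 1 ∧ n = 1)) (v : ℝ → (Fin m → E3) → (Fin n → E3) → ℂ) :
    wickForm χ v (ballVector k₀ ε) (ballVector k₀ ε) = 0 := by
  unfold wickForm
  refine (tsum_congr fun l => ?_).trans tsum_zero
  by_cases hm : m + l = 1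
  · have hn : n + l ≠ 1 := fun hn => hne (by omega)
    simp [annihilateCut_ballVector_of_ne χ k₀ ε hn]
  · simp [annihilateCut_ballVector_of_ne χ k₀ ε hm]

theorem append_fin_zero (k : Fin 1 → E3) (q : Fin 0 → E3) :
    (Fin.append k q : Fin 1 → E3) = k := by
  funext i
  exact Fin.append_left k q i

/-- Phrased as a property of the concatenated momentum $k$, so that `ae_append_left` and
`ae_append_right` can transport it to the integration space of `wickForm`. -/
theorem ae_annihilateCut_eq_zero (χ : ℝ → ℝ) (k₀ : E3) (ε : ℝ) :
    ∀ᵐ k : Fin (1 + 0) → E3, ∀ (p : Fin 1 → E3) (q : Fin 0 → E3), Fin.append p q = k →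
      p ∉ Metric.ball (fun _ : Fin 1 => k₀) ε → annihilateCut χ (ballVector k₀ ε) p q = 0 := by
  filter_upwards [wave_ballVector_one k₀ ε] with k hk p q hpq hp
  have hkp : k = p := hpq.symm.trans (append_fin_zero p q)
  unfold annihilateCut
  rw [hpq]
  have : wave (ballVector k₀ ε) (1 + 0) k = 0 := by
    rw [hk, hkp, indicator_of_notMem hp]
  rw [this, mul_zero, mul_zero]

theorem ae_norm_annihilateCut_le {χ : ℝ → ℝ} (hχ : IsCutoff χ) (k₀ : E3) (ε : ℝ) :
    ∀ᵐ k : Fin (1 + 0) → E3, ∀ (p : Fin 1 → E3) (q : Fin 0 → E3), Fin.append p q = k →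
      ‖annihilateCut χ (ballVector k₀ ε) p q‖ ≤ 1 := by
  filter_upwards [wave_ballVector_one k₀ ε] with k hk p q hpq
  unfold annihilateCut
  rw [hpq, norm_mul, norm_mul]
  have h1 : ‖wave (ballVector k₀ ε) (1 + 0) k‖ ≤ 1 := by
    rw [hk]
    exact (norm_indicator_le_norm_self _ _).trans (by simp)
  have h2 := hχ.mem_Icc (energy k)
  have h3 : ‖(χ (energy k) : ℂ)‖ ≤ 1 := by
    rw [Complex.norm_real, Real.norm_of_nonneg h2.1]; exact h2.2
  simpa using mul_le_one₀ h3 (norm_nonneg _) h1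

theorem norm_weight_le {a : ℝ} (ha : 0 < a) {p q : Fin 1 → E3} (hp : a ≤ ‖p 0‖)
    (hq : a ≤ ‖q 0‖) :
    ‖((((∏ i, ‖p i‖) * ∏ i, ‖q i‖) ^ (-(1 / 2) : ℝ) : ℝ) : ℂ)‖ ≤ a⁻¹ := by
  have hprod : a * a ≤ ‖p 0‖ * ‖q 0‖ := mul_le_mul hp hq ha.le (norm_nonneg _)
  simp only [Finset.univ_unique, Fin.default_eq_zero, Finset.prod_singleton]
  rw [Complex.norm_real, Real.norm_of_nonneg (by positivity)]
  refine (Real.rpow_le_rpow_of_nonpos (by positivity) hprod (by norm_num)).trans_eq ?_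
  rw [Real.rpow_neg (by positivity), ← Real.sqrt_eq_rpow, Real.sqrt_mul_self ha.le]

theorem half_norm_le_of_mem_ball {k₀ : E3} {ε : ℝ} (hε : ε ≤ ‖k₀‖ / 2) {k : Fin 1 → E3}
    (hk : k ∈ Metric.ball (fun _ : Fin 1 => k₀) ε) : ‖k₀‖ / 2 ≤ ‖k 0‖ := by
  have h := (abs_le.1 (energy_mem_of_mem_ball hk)).1
  simp only [energy, Finset.univ_unique, Fin.default_eq_zero, Finset.sum_singleton] at h
  linarith

/-- Each of the two vectors confines one momentum to the ball, which produces the square of the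
volume. There both momenta have norm at least $\|k_0\|/2$, whence the weight $2/\|k_0\|$. No
spectator particle remains, so only $v$ at energy $0$ matters. -/
theorem norm_wickForm_ballVector_le {χ : ℝ → ℝ} (hχ : IsCutoff χ) {k₀ : E3} {ε : ℝ}
    (hk₀ : 0 < ‖k₀‖) (hε : ε ≤ ‖k₀‖ / 2) {v : ℝ → (Fin 1 → E3) → (Fin 1 → E3) → ℂ} {C : ℝ}
    (hC : 0 ≤ C) (hv : ∀ᵐ k ∂(ballMeasure 1 1), ‖v 0 k.1 k.2‖ ≤ C) :
    ‖wickForm χ v (ballVector k₀ ε) (ballVector k₀ ε)‖ ≤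
      2 / ‖k₀‖ * C * (ballVolume ε * ballVolume ε) := by
  set A := Metric.ball (fun _ : Fin 1 => k₀) ε with hA
  unfold wickForm
  rw [tsum_eq_single 0 fun l hl => by
    have : 1 + l ≠ 1 := by omega
    simp [annihilateCut_ballVector_of_ne χ k₀ ε this]]
  set T : Set (((Fin 1 → E3) × (Fin 1 → E3)) × (Fin 0 → E3)) := (A ×ˢ A) ×ˢ univ with hT
  set ν := (ballMeasure 1 1).prod (volume : Measure (Fin 0 → E3)) with hν
  have hνT : ν T ≤ ENNReal.ofReal (ballVolume ε * ballVolume ε) := by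
    have hle : ν ≤ (volume.prod volume).prod volume :=
      Measure.prod_mono Measure.restrict_le_self le_rfl
    refine (hle T).trans_eq ?_
    -- The spectator space for $l=0$ is a point of mass one.
    have hvol : (volume : Measure (Fin 0 → E3)) univ = 1 := by
      rw [volume_pi, Measure.pi_univ]; simp
    rw [hT, Measure.prod_prod, Measure.prod_prod, hvol, mul_one,
      ← ballVolume_eq k₀, ENNReal.ofReal_mul measureReal_nonneg,
      ofReal_measureReal measure_ball_lt_top.ne]
  rw [← setIntegral_eq_integral_of_ae_compl_eq_zero (s := T)]
  · refine (norm_setIntegral_le_of_norm_le_const_ae' (C := 2 / ‖k₀‖ * C)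
      (hνT.trans_lt ENNReal.ofReal_lt_top) ?_).trans ?_
    · filter_upwards [ae_append_left (m := 1) (n := 1) (ae_norm_annihilateCut_le hχ k₀ ε),
        ae_append_right (m := 1) (n := 1) (ae_norm_annihilateCut_le hχ k₀ ε),
        Measure.quasiMeasurePreserving_fst.ae hv] with x h1 h2 h3 hx
      obtain ⟨⟨hx1, hx2⟩, -⟩ := hx
      have hq : energy x.2 = 0 := by simp [energy]
      have hw := norm_weight_le (half_pos hk₀) (half_norm_le_of_mem_ball hε hx1)
        (half_norm_le_of_mem_ball hε hx2)
      rw [inv_div] at hw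
      rw [norm_mul, norm_mul, norm_mul, norm_star, hq]
      have h4 := mul_le_mul h3 (h2 _ _ rfl) (norm_nonneg _) hC
      have h5 := mul_le_mul (h1 _ _ rfl) h4 (by positivity) zero_le_one
      have h6 := mul_le_mul hw h5 (by positivity) (by positivity)
      simpa using h6
    · refine mul_le_mul_of_nonneg_left ?_ (by positivity)
      exact ENNReal.toReal_le_of_le_ofReal
        (mul_nonneg ENNReal.toReal_nonneg ENNReal.toReal_nonneg) hνT
  · filter_upwards [ae_append_left (m := 1) (n := 1) (ae_annihilateCut_eq_zero χ k₀ ε),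
      ae_append_right (m := 1) (n := 1) (ae_annihilateCut_eq_zero χ k₀ ε)] with x h1 h2 hx
    by_cases h : x.1.1 ∈ A
    · rw [h2 _ _ rfl fun h' => hx ⟨⟨h, h'⟩, trivial⟩]; simp
    · rw [h1 _ _ rfl h]; simp

/-- The weights $\xi^{-2}$ and $|k|^{-\mu}$ are at least $1$ on the unit ball and can be dropped.
The maximum with $0$ reflects the truncation in `ENNReal.ofReal γ`. -/
theorem ae_norm_le_of_interactionNorm_le {μ : ℝ} (hμ : 0 ≤ μ) {s : ℕ} {ξ : ℝ} (hξ0 : 0 < ξ)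
    (hξ1 : ξ < 1) {w : Coupling} {γ : ℝ} (hγ : interactionNorm μ s ξ w ≤ ENNReal.ofReal γ) :
    ∀ᵐ k ∂(ballMeasure 1 1), ‖w 1 1 0 k.1 k.2‖ ≤ max γ 0 := by
  have h1 : derivNorm μ 0 (w 1 1) ≤ ENNReal.ofReal γ := by
    refine le_trans ?_ hγ
    refine le_trans ?_ (ENNReal.le_tsum (⟨(1, 1), by norm_num⟩ : PosPair))
    refine le_trans (Finset.single_le_sum (f := fun ν => derivNorm μ ν (w 1 1))
      (fun _ _ => zero_le) (Finset.mem_range.2 (Nat.succ_pos s))) ?_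
    refine le_mul_of_one_le_left (zero_le) (ENNReal.one_le_ofReal.2 ?_)
    exact (one_le_inv₀ (by positivity)).2 (pow_le_one₀ hξ0.le hξ1.le)
  have hmeas : MeasurableSet (ballPow 1 ×ˢ ballPow 1) := by
    have : IsClosed (ballPow 1) := by
      have : ballPow 1 = ⋂ i, {k : Fin 1 → E3 | ‖k i‖ ≤ 1} := by ext; simp [ballPow]
      rw [this]
      exact isClosed_iInter fun i => isClosed_le (by fun_prop) (by fun_prop)
    exact this.measurableSet.prod this.measurableSet
  filter_upwards [ENNReal.ae_le_essSup (μ := ballMeasure 1 1)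
    (fun k : (Fin 1 → E3) × (Fin 1 → E3) => ⨆ j : Fin 1 ⊕ Fin 1, ⨆ r ∈ Icc (0 : ℝ) 1,
      ‖iteratedDerivWithin 0 (fun r => w 1 1 r k.1 k.2) (Icc 0 1) r‖ₑ
        / ‖Sum.elim k.1 k.2 j‖ₑ ^ μ), ae_restrict_mem hmeas] with k hk hmem
  have h2 := (le_iSup₂_of_le (f := fun (j : Fin 1 ⊕ Fin 1) (r : ℝ) => ⨆ _ : r ∈ Icc (0 : ℝ) 1,
      ‖iteratedDerivWithin 0 (fun r => w 1 1 r k.1 k.2) (Icc 0 1) r‖ₑ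
        / ‖Sum.elim k.1 k.2 j‖ₑ ^ μ) (Sum.inl 0) 0
      (le_iSup_of_le (by simp) le_rfl)).trans (hk.trans h1)
  rw [iteratedDerivWithin_zero] at h2
  have h3 : ‖k.1 0‖ₑ ^ μ ≤ 1 := by
    refine ENNReal.rpow_le_one ?_ hμ
    rw [← ofReal_norm]
    exact ENNReal.ofReal_le_one.2 (hmem.1 0)
  have h4 : ‖w 1 1 0 k.1 k.2‖ₑ ≤ ENNReal.ofReal γ := by
    refine le_trans ?_ h2
    rw [ENNReal.div_eq_inv_mul]
    exact le_mul_of_one_le_left (zero_le) (ENNReal.one_le_inv.2 h3)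
  rw [← ofReal_norm, ENNReal.ofReal_le_ofReal_iff'] at h4
  rcases h4 with h4 | h4
  · exact h4.trans (le_max_left _ _)
  · exact h4.trans (le_max_right _ _)

/-- Of the whole series only the term $(1,1)$ survives. If the series is not summable, `interaction`
is $0$ and the bound is trivial. -/
theorem norm_inner_interaction_ballVector_le {χ : ℝ → ℝ} (hχ : IsCutoff χ) {μ : ℝ} (hμ : 0 ≤ μ)
    {s : ℕ} {ξ : ℝ} (hξ0 : 0 < ξ) (hξ1 : ξ < 1) {w : Coupling} {γ : ℝ}
    (hγ : interactionNorm μ s ξ w ≤ ENNReal.ofReal γ) {k₀ : E3} {ε : ℝ}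
    (hk₀ : 0 < ‖k₀‖) (hε : ε ≤ ‖k₀‖ / 2) :
    ‖(inner ℂ (ballVector k₀ ε) (interaction χ w (ballVector k₀ ε)) : ℂ)‖ ≤
      2 / ‖k₀‖ * max γ 0 * (ballVolume ε * ballVolume ε) := by
  have hV : 0 ≤ ballVolume ε := ENNReal.toReal_nonneg
  set f := ballVector k₀ ε
  unfold interaction
  by_cases hs : Summable fun q : PosPair => wickOp χ (w q.1.1 q.1.2)
  · have e : (inner ℂ f ((∑' q : PosPair, wickOp χ (w q.1.1 q.1.2)) f) : ℂ) =
        ∑' q : PosPair, inner ℂ f (wickOp χ (w q.1.1 q.1.2) f) :=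
      (innerSL ℂ f ∘L ContinuousLinearMap.apply ℂ Fock f).map_tsum hs
    rw [e, tsum_eq_single (⟨(1, 1), by norm_num⟩ : PosPair)]
    · rcases inner_wickOp (χ := χ) (w 1 1) with h | h
      · simp only [h, zero_apply, inner_zero_right, norm_zero]
        positivity
      · rw [h]
        exact norm_wickForm_ballVector_le hχ hk₀ hε (le_max_right _ _)
          (ae_norm_le_of_interactionNorm_le hμ hξ0 hξ1 hγ)
    · rintro ⟨⟨m, n⟩, hmn⟩ hne
      rcases inner_wickOp (χ := χ) (w m n) with h | h
      · simp [h]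
      · rw [h]
        refine wickForm_ballVector_eq_zero χ k₀ ε hmn (fun h1 => hne ?_) _
        exact Subtype.ext (Prod.ext h1.1 h1.2)
  · rw [tsum_eq_zero_of_not_summable hs]
    simp only [zero_apply, inner_zero_right, norm_zero]
    positivity

/-! ### Recovering $w_{0,0}$ from $H(w)$ -/

/-- The energy is at most $\|k_0\|+\varepsilon$ on the ball, so $H_f$ acts on this vector like the
bounded function $\min(|t|,C)$ of $H_f$. -/
theorem ballVector_mem_domain (k₀ : E3) (ε : ℝ) :
    ballVector k₀ ε ∈ fieldHamiltonian.domain := by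
  set C := |‖k₀‖ + ε| with hC
  set g : BoundedContinuousFunction ℝ ℂ := BoundedContinuousFunction.ofNormedAddCommGroup
    (fun t : ℝ => ((min |t| C : ℝ) : ℂ)) (by fun_prop) C (fun t => by
      rw [Complex.norm_real, Real.norm_of_nonneg (by positivity)]
      exact min_le_right _ _)
  refine ⟨boundedFieldFun g (ballVector k₀ ε), fun n => ?_⟩
  have h1 := isFieldFun_boundedFieldFun g (ballVector k₀ ε) n
  by_cases hn : n = 1
  · subst hn
    filter_upwards [h1, wave_ballVector_one k₀ ε] with k h2 h3
    rw [h2]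
    by_cases hk : k ∈ Metric.ball (fun _ : Fin 1 => k₀) ε
    · have h4 := (abs_le.1 (energy_mem_of_mem_ball hk)).2
      have h5 : energy k ≤ C := le_trans (by linarith) (le_abs_self _)
      have : g (energy k) = (energy k : ℂ) := by
        change ((min |energy k| C : ℝ) : ℂ) = _
        rw [abs_of_nonneg (energy_nonneg k), min_eq_left h5]
      rw [this]
    · rw [h3, indicator_of_notMem hk, mul_zero, mul_zero]
  · filter_upwards [h1] with k h2
    rw [h2, wave_ballVector_of_ne k₀ ε hn, mul_zero, mul_zero]

/-- The vector `(H_f + 1) f`, for the one-particle vector `f = ballVector k₀ ε`. -/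
def shiftedBallVector (k₀ : E3) (ε : ℝ) : Fock :=
  fieldHamiltonian ⟨ballVector k₀ ε, ballVector_mem_domain k₀ ε⟩ + ballVector k₀ ε

/-- The functional `B ↦ ⟨f, B (H_f + 1) f⟩ / ⟨f, f⟩`, for `f = ballVector k₀ ε`. -/
def ballAverage (k₀ : E3) (ε : ℝ) : (Fock →L[ℂ] Fock) →L[ℂ] ℂ :=
  (ballVolume ε : ℂ)⁻¹ • (innerSL ℂ (ballVector k₀ ε) ∘L
    ContinuousLinearMap.apply ℂ Fock (shiftedBallVector k₀ ε))

/-- The domain of a sum of partial maps is the intersection of the domains, so $H_f$-boundedness of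
$H(w)$ already places the domain of $H_f$ inside that of $w_{0,0}(H_f)$. -/
theorem IsFieldBounded.exists_hamiltonian {χ : ℝ → ℝ} {w : Coupling} {B : Fock →L[ℂ] Fock}
    (hB : IsFieldBounded (hamiltonian χ w) B) (ψ : fieldHamiltonian.domain) :
    ∃ η, IsFieldFun (w00 w) ψ η ∧
      η + interaction χ w ψ = B (fieldHamiltonian ψ + (ψ : Fock)) := by
  obtain ⟨h, e⟩ := hB.2 ψ
  exact ⟨fieldFun (w00 w) ⟨ψ, h.1⟩, isFieldFun_fieldFun _, e⟩

/-- Quantitative bounds on a sequence of coupling functions: `w_{0,0}` is Lipschitz on `[0,∞)`, and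
the norm of the interaction is bounded. -/
structure IsCouplingBound (μ : ℝ) (s : ℕ) (ξ L γ : ℝ) (w : Coupling) : Prop where
  lipschitz : ∀ a b : ℝ, 0 ≤ a → 0 ≤ b → ‖w00 w a - w00 w b‖ ≤ L * |a - b|
  interaction_le : interactionNorm μ s ξ w ≤ ENNReal.ofReal γ

theorem inv_mul_inner_add_sub {E : Type*} [NormedAddCommGroup E] [InnerProductSpace ℂ E]
    {f : E} {V : ℂ} (hV : V ≠ 0) (hf : inner ℂ f f = V) (η ζ : E) (c : ℂ) :
    V⁻¹ * inner ℂ f (η + ζ) - c = V⁻¹ * (inner ℂ f (η - c • f) + inner ℂ f ζ) := by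
  rw [inner_add_right, inner_sub_right, inner_smul_right, hf]
  field_simp
  ring

theorem norm_inner_ballVector_sub_le {f : ℝ → ℂ} {L : ℝ}
    (hL : ∀ a b : ℝ, 0 ≤ a → 0 ≤ b → ‖f a - f b‖ ≤ L * |a - b|) {k₀ : E3} {ε : ℝ} {η : Fock}
    (hη : IsFieldFun f (ballVector k₀ ε) η) :
    ‖(inner ℂ (ballVector k₀ ε) (η - f ‖k₀‖ • ballVector k₀ ε) : ℂ)‖ ≤
      |L| * ε * ballVolume ε := by
  rw [inner_ballVector, ← ballVolume_eq k₀ ε]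
  refine norm_setIntegral_le_of_norm_le_const_ae' measure_ball_lt_top ?_
  have hsub : wave (η - f ‖k₀‖ • ballVector k₀ ε) 1 =ᵐ[volume]
      wave η 1 - wave (f ‖k₀‖ • ballVector k₀ ε) 1 := Lp.coeFn_sub _ _
  filter_upwards [hsub, hη 1, wave_smul (f ‖k₀‖) (ballVector k₀ ε) 1,
    wave_ballVector_one k₀ ε] with k h1 h2 h3 h4 hk
  rw [h1, Pi.sub_apply, h2, h3, Pi.smul_apply, h4, indicator_of_mem hk, smul_eq_mul, mul_one,
    mul_one]
  refine (hL _ _ (energy_nonneg k) (norm_nonneg _)).trans ?_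
  exact mul_le_mul (le_abs_self L) (energy_mem_of_mem_ball hk) (abs_nonneg _) (abs_nonneg _)

/-- The function `w_{0,0}` can be recovered from `H(w)` by expectations in one-particle states. -/
theorem norm_ballAverage_sub_le {χ : ℝ → ℝ} (hχ : IsCutoff χ) {μ : ℝ} (hμ : 0 ≤ μ)
    {s : ℕ} {ξ : ℝ} (hξ0 : 0 < ξ) (hξ1 : ξ < 1) {w : Coupling} {L γ : ℝ}
    (hw : IsCouplingBound μ s ξ L γ w) {B : Fock →L[ℂ] Fock}
    (hB : IsFieldBounded (hamiltonian χ w) B) {k₀ : E3} {ε : ℝ} (hε0 : 0 < ε)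
    (hk₀ : 0 < ‖k₀‖) (hε : ε ≤ ‖k₀‖ / 2) :
    ‖ballAverage k₀ ε B - w00 w ‖k₀‖‖ ≤
      |L| * ε + 2 / ‖k₀‖ * max γ 0 * ballVolume ε := by
  have hV := ballVolume_pos hε0
  have hVne : (ballVolume ε : ℂ) ≠ 0 := by exact_mod_cast hV.ne'
  obtain ⟨η, hη, e⟩ := hB.exists_hamiltonian ⟨ballVector k₀ ε, ballVector_mem_domain k₀ ε⟩
  have hAv : ballAverage k₀ ε B =
      (ballVolume ε : ℂ)⁻¹ * inner ℂ (ballVector k₀ ε) (B (shiftedBallVector k₀ ε)) := rfl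
  have hW := norm_inner_interaction_ballVector_le (χ := χ) hχ hμ hξ0 hξ1 hw.interaction_le hk₀ hε
  have hfree := norm_inner_ballVector_sub_le hw.lipschitz hη
  have hsplit : ballAverage k₀ ε B - w00 w ‖k₀‖ = (ballVolume ε : ℂ)⁻¹ *
      (inner ℂ (ballVector k₀ ε) (η - w00 w ‖k₀‖ • ballVector k₀ ε) +
        inner ℂ (ballVector k₀ ε) (interaction χ w (ballVector k₀ ε))) := by
    rw [hAv, shiftedBallVector, ← e]
    exact inv_mul_inner_add_sub hVne (inner_ballVector_self k₀ ε) _ _ _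
  rw [hsplit, norm_mul, norm_inv, Complex.norm_real, Real.norm_of_nonneg hV.le,
    inv_mul_le_iff₀ hV]
  refine (norm_add_le _ _).trans ((add_le_add hfree hW).trans_eq ?_)
  ring

open Filter Topology in
theorem tendsto_averageError (L γ r : ℝ) :
    Tendsto (fun ε => |L| * ε + 2 / r * max γ 0 * ballVolume ε) (𝓝[>] 0) (𝓝 0) := by
  have h1 : Tendsto (fun ε : ℝ => |L| * ε) (𝓝[>] 0) (𝓝 0) := by
    have : Continuous fun ε : ℝ => |L| * ε := by fun_prop
    exact (this.tendsto' 0 0 (by simp)).mono_left nhdsWithin_le_nhds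
  simpa using h1.add (tendsto_ballVolume.const_mul (2 / r * max γ 0))

theorem exists_norm_eq (r : ℝ) (hr : 0 ≤ r) : ∃ k : E3, ‖k‖ = r :=
  ⟨EuclideanSpace.single 0 r, by simp [abs_of_nonneg hr]⟩

theorem IsCouplingBound.continuousOn {μ : ℝ} {s : ℕ} {ξ L γ : ℝ} {w : Coupling}
    (hw : IsCouplingBound μ s ξ L γ w) : ContinuousOn (w00 w) (Ici 0) := by
  have : LipschitzOnWith L.toNNReal (w00 w) (Ici 0) :=
    LipschitzOnWith.of_dist_le_mul fun a ha b hb => by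
      rw [dist_eq_norm, dist_eq_norm]
      exact (hw.lipschitz a b ha hb).trans
        (mul_le_mul_of_nonneg_right (Real.le_coe_toNNReal L) (abs_nonneg _))
  exact this.continuousOn

open Filter Topology in
/-- `H(w)` determines `w_{0,0}`. -/
theorem w00_eq_of_hamiltonian_eq {χ : ℝ → ℝ} (hχ : IsCutoff χ) {μ : ℝ} (hμ : 0 ≤ μ)
    {s : ℕ} {ξ : ℝ} (hξ0 : 0 < ξ) (hξ1 : ξ < 1) {w w' : Coupling} {L γ L' γ' : ℝ}
    (hw : IsCouplingBound μ s ξ L γ w) (hw' : IsCouplingBound μ s ξ L' γ' w')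
    {B : Fock →L[ℂ] Fock} (hB : IsFieldBounded (hamiltonian χ w) B)
    (hB' : IsFieldBounded (hamiltonian χ w') B) : EqOn (w00 w) (w00 w') (Ici 0) := by
  have hpos : EqOn (w00 w) (w00 w') (Ioi 0) := by
    intro r hr
    obtain ⟨k₀, rfl⟩ := exists_norm_eq r (le_of_lt hr)
    have hr' : 0 < ‖k₀‖ := hr
    -- The averages depend on $B$ alone, so both functions are limits of the same quantity.
    have key : ∀ {w : Coupling} {L γ : ℝ}, IsCouplingBound μ s ξ L γ w →
        IsFieldBounded (hamiltonian χ w) B →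
        Tendsto (fun ε => ballAverage k₀ ε B) (𝓝[>] 0) (𝓝 (w00 w ‖k₀‖)) := by
      intro w L γ hw hB
      rw [tendsto_iff_norm_sub_tendsto_zero]
      refine squeeze_zero' (.of_forall fun _ => norm_nonneg _) ?_
        (tendsto_averageError L γ ‖k₀‖)
      filter_upwards [Ioc_mem_nhdsGT (half_pos hr')] with ε hε
      exact norm_ballAverage_sub_le hχ hμ hξ0 hξ1 hw hB hε.1 hr' hε.2
    exact tendsto_nhds_unique (key hw hB) (key hw' hB')
  exact hpos.of_subset_closure hw.continuousOn hw'.continuousOn Ioi_subset_Ici_self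
    (by rw [closure_Ioi])

/-! ### Splitting $H(w)(H_f+1)^{-1}$ into free part and interaction -/

/-- The function `w_{0,0}(r) / (1 + r)`, extended to negative `r`. -/
def freeQuotientFun (w : Coupling) (t : ℝ) : ℂ := w00 w (max t 0) / (1 + max t 0 : ℝ)

theorem IsCouplingBound.continuous_freeQuotientFun {μ : ℝ} {s : ℕ} {ξ L γ : ℝ} {w : Coupling}
    (hw : IsCouplingBound μ s ξ L γ w) : Continuous (freeQuotientFun w) := by
  refine Continuous.div ?_ (by fun_prop) fun t => ?_
  · exact hw.continuousOn.comp_continuous (by fun_prop) fun t => le_max_right t 0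
  · have : (0 : ℝ) < 1 + max t 0 := by positivity
    exact_mod_cast this.ne'

theorem IsCouplingBound.norm_freeQuotientFun_le {μ : ℝ} {s : ℕ} {ξ L γ : ℝ} {w : Coupling}
    (hw : IsCouplingBound μ s ξ L γ w) (t : ℝ) :
    ‖freeQuotientFun w t‖ ≤ ‖w00 w 0‖ + |L| := by
  have ht : 0 ≤ max t 0 := le_max_right t 0
  unfold freeQuotientFun
  set r := max t 0
  have hr : 0 < 1 + r := by positivity
  rw [norm_div, Complex.norm_real, Real.norm_of_nonneg hr.le, div_le_iff₀ hr]
  have h1 : ‖w00 w r‖ ≤ ‖w00 w 0‖ + L * r := by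
    have h2 := hw.lipschitz r 0 ht le_rfl
    rw [sub_zero, abs_of_nonneg ht] at h2
    have h3 := norm_sub_norm_le (w00 w r) (w00 w 0)
    linarith
  have h4 := mul_le_mul_of_nonneg_right (le_abs_self L) ht
  nlinarith [norm_nonneg (w00 w 0), abs_nonneg L, mul_nonneg (norm_nonneg (w00 w 0)) ht]

open Classical in
/-- `freeQuotientFun` as a bounded continuous function. -/
def freeQuotient (w : Coupling) : BoundedContinuousFunction ℝ ℂ :=
  if h : Continuous (freeQuotientFun w) ∧ ∃ C, ∀ t, ‖freeQuotientFun w t‖ ≤ C then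
    BoundedContinuousFunction.ofNormedAddCommGroup _ h.1 _ h.2.choose_spec
  else 0

theorem IsCouplingBound.freeQuotient_apply {μ : ℝ} {s : ℕ} {ξ L γ : ℝ} {w : Coupling}
    (hw : IsCouplingBound μ s ξ L γ w) (t : ℝ) : freeQuotient w t = freeQuotientFun w t := by
  unfold freeQuotient
  rw [dif_pos ⟨hw.continuous_freeQuotientFun, _, hw.norm_freeQuotientFun_le⟩]
  rfl

theorem IsCouplingBound.norm_freeQuotient_le {μ : ℝ} {s : ℕ} {ξ L γ : ℝ} {w : Coupling}
    (hw : IsCouplingBound μ s ξ L γ w) : ‖freeQuotient w‖ ≤ ‖w00 w 0‖ + |L| :=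
  (BoundedContinuousFunction.norm_le (by positivity)).2 fun t => by
    rw [hw.freeQuotient_apply]; exact hw.norm_freeQuotientFun_le t

/-- `w_{0,0}(H_f) = [w_{0,0}(H_f) (H_f + 1)⁻¹] (H_f + 1)`. -/
theorem IsCouplingBound.isFieldFun_freeQuotient {μ : ℝ} {s : ℕ} {ξ L γ : ℝ} {w : Coupling}
    (hw : IsCouplingBound μ s ξ L γ w) (ψ : fieldHamiltonian.domain) :
    IsFieldFun (w00 w) ψ
      (boundedFieldFun (freeQuotient w) (fieldHamiltonian ψ + (ψ : Fock))) := by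
  have h1 : IsFieldFun (fun r => (r : ℂ)) ψ (fieldHamiltonian ψ) := isFieldFun_fieldFun ψ
  have h2 : IsFieldFun (fun _ => (1 : ℂ)) (ψ : Fock) (ψ : Fock) := fun n => by
    simp only [one_mul]; rfl
  refine ((h1.add_fun h2).mul (isFieldFun_boundedFieldFun _ _)).congr fun r hr => ?_
  rw [hw.freeQuotient_apply, freeQuotientFun, max_eq_left hr]
  have : ((1 + r : ℝ) : ℂ) ≠ 0 := by
    have : (0 : ℝ) < 1 + r := by positivity
    exact_mod_cast this.ne'
  simp only [Pi.add_apply]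
  rw [add_comm (r : ℂ) 1]
  push_cast at this ⊢
  field_simp

theorem IsCouplingBound.isFieldBounded_fieldFun {μ : ℝ} {s : ℕ} {ξ L γ : ℝ} {w : Coupling}
    (hw : IsCouplingBound μ s ξ L γ w) :
    IsFieldBounded (fieldFun (w00 w)) (boundedFieldFun (freeQuotient w)) :=
  ⟨isClosed_fieldFun _, fun ψ => ⟨⟨_, hw.isFieldFun_freeQuotient ψ⟩,
    fieldFun_eq (hw.isFieldFun_freeQuotient ψ) _⟩⟩

theorem IsCouplingBound.interaction_apply {χ : ℝ → ℝ} {μ : ℝ} {s : ℕ} {ξ L γ : ℝ} {w : Coupling}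
    (hw : IsCouplingBound μ s ξ L γ w) {B : Fock →L[ℂ] Fock}
    (hB : IsFieldBounded (hamiltonian χ w) B) (ψ : fieldHamiltonian.domain) :
    interaction χ w ψ =
      (B - boundedFieldFun (freeQuotient w)) (fieldHamiltonian ψ + (ψ : Fock)) := by
  obtain ⟨η, hη, e⟩ := hB.exists_hamiltonian ψ
  rw [sub_apply, ← e, hη.unique (hw.isFieldFun_freeQuotient ψ)]
  abel

theorem IsCouplingBound.interaction_apply_of_isFieldFun {χ : ℝ → ℝ} {μ : ℝ} {s : ℕ} {ξ L γ : ℝ}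
    {w : Coupling} (hw : IsCouplingBound μ s ξ L γ w) {B : Fock →L[ℂ] Fock}
    (hB : IsFieldBounded (hamiltonian χ w) B) {ψ η : Fock}
    (h : IsFieldFun (fun r => (r : ℂ)) ψ η) :
    interaction χ w ψ = (B - boundedFieldFun (freeQuotient w)) (η + ψ) := by
  have e : fieldHamiltonian ⟨ψ, η, h⟩ = η := fieldFun_eq h _
  have h1 := hw.interaction_apply hB ⟨ψ, η, h⟩
  rwa [e] at h1

theorem IsCouplingBound.isFieldBounded_interaction {χ : ℝ → ℝ} {μ : ℝ} {s : ℕ} {ξ L γ : ℝ}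
    {w : Coupling} (hw : IsCouplingBound μ s ξ L γ w) {B : Fock →L[ℂ] Fock}
    (hB : IsFieldBounded (hamiltonian χ w) B) :
    IsFieldBounded (toUnbounded (interaction χ w)) (B - boundedFieldFun (freeQuotient w)) :=
  ⟨isClosed_toUnbounded _, fun ψ => ⟨trivial, hw.interaction_apply hB ψ⟩⟩

/-! ### Recovering $W$ from $W(H_f+1)^{-1}$ -/

theorem max_one_abs_pos (t : ℝ) : 0 < max 1 |t| := lt_max_of_lt_left one_pos

/-- A bounded function of `r ≥ 0` which is `1` for `r ≤ 1` and decays like `1 / r`. -/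
def energyCutoff : BoundedContinuousFunction ℝ ℂ :=
  BoundedContinuousFunction.ofNormedAddCommGroup (fun t : ℝ => (((max 1 |t|)⁻¹ : ℝ) : ℂ))
    (Complex.continuous_ofReal.comp (Continuous.inv₀ (by fun_prop) fun t => (max_one_abs_pos t).ne'))
    1 fun t => by
      rw [Complex.norm_real, Real.norm_of_nonneg (by positivity)]
      exact inv_le_one_of_one_le₀ (le_max_left _ _)

theorem energyCutoff_eq_one (r : ℝ) (h0 : 0 ≤ r) (h1 : r ≤ 1) : energyCutoff r = 1 := by
  change (((max 1 |r|)⁻¹ : ℝ) : ℂ) = 1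
  rw [abs_of_nonneg h0, max_eq_left h1]; simp

/-- The bounded function `r * energyCutoff r` of `r ≥ 0`. -/
def energyMulCutoff : BoundedContinuousFunction ℝ ℂ :=
  BoundedContinuousFunction.ofNormedAddCommGroup (fun t : ℝ => ((|t| * (max 1 |t|)⁻¹ : ℝ) : ℂ))
    (Complex.continuous_ofReal.comp (continuous_abs.mul
      (Continuous.inv₀ (by fun_prop) fun t => (max_one_abs_pos t).ne')))
    1 fun t => by
      rw [Complex.norm_real, Real.norm_of_nonneg (by positivity), ← div_eq_mul_inv]
      exact div_le_one_of_le₀ (le_max_right _ _) (by positivity)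

/-- The cut-off maps all of Fock space into the domain of $H_f$; this is where its decay like $1/r$
is needed. -/
theorem isFieldFun_energyMulCutoff (ψ : Fock) :
    IsFieldFun (fun r => (r : ℂ)) (boundedFieldFun energyCutoff ψ)
      (boundedFieldFun energyMulCutoff ψ) := fun n => by
  filter_upwards [isFieldFun_boundedFieldFun energyCutoff ψ n,
    isFieldFun_boundedFieldFun energyMulCutoff ψ n] with k h1 h2
  rw [h1, h2]
  change ((|energy k| * (max 1 |energy k|)⁻¹ : ℝ) : ℂ) * _ =
    _ * ((((max 1 |energy k|)⁻¹ : ℝ) : ℂ) * _)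
  rw [abs_of_nonneg (energy_nonneg k)]
  push_cast
  ring

/-- Since `W(w)` only acts at energies at most one, it can be recovered from
`W(w) (H_f + 1)⁻¹`. -/
theorem IsCouplingBound.interaction_eq {χ : ℝ → ℝ} (hχ : IsCutoff χ) {μ : ℝ} {s : ℕ} {ξ L γ : ℝ}
    {w : Coupling} (hw : IsCouplingBound μ s ξ L γ w) {B : Fock →L[ℂ] Fock}
    (hB : IsFieldBounded (hamiltonian χ w) B) :
    interaction χ w = (B - boundedFieldFun (freeQuotient w)) ∘L
      (boundedFieldFun energyMulCutoff + boundedFieldFun energyCutoff) := by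
  refine ContinuousLinearMap.ext fun ψ => ?_
  have h := interaction_eq_of_isFieldFun hχ w energyCutoff_eq_one
    (isFieldFun_boundedFieldFun energyCutoff ψ)
  exact h.symm.trans (hw.interaction_apply_of_isFieldFun hB (isFieldFun_energyMulCutoff ψ))

/-! ### Lipschitz bounds from the coupling norms -/

theorem lipschitz_of_norm_derivWithin_le {f : ℝ → ℂ} {L : ℝ} (hf : DifferentiableOn ℝ f (Ici 0))
    (hL : ∀ r ∈ Ici (0 : ℝ), ‖derivWithin f (Ici 0) r‖ ≤ L) (a b : ℝ) (ha : 0 ≤ a) (hb : 0 ≤ b) :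
    ‖f a - f b‖ ≤ L * |a - b| :=
  (convex_Ici 0).norm_image_sub_le_of_norm_derivWithin_le hf hL hb ha

theorem differentiableOn_w00 {μ : ℝ} {s : ℕ} (hs : 1 ≤ s) {ξ : ℝ} {w : Coupling}
    (hw : w ∈ couplingSpace μ s ξ) : DifferentiableOn ℝ (w00 w) (Ici 0) :=
  hw.1.differentiableOn (by exact_mod_cast (Nat.one_le_iff_ne_zero.1 hs))

/-- These constants depend on $w$. They suffice for the algebraic identities, but not for uniform
limits in the parameter. -/
theorem exists_isCouplingBound {μ : ℝ} {s : ℕ} (hs : 1 ≤ s) {ξ : ℝ} {w : Coupling}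
    (hw : w ∈ couplingSpace μ s ξ) : ∃ L γ, IsCouplingBound μ s ξ L γ w := by
  have hfin := ENNReal.add_lt_top.1 hw.2.2
  set N := ⨆ r ∈ Ici (0 : ℝ), ‖iteratedDerivWithin 1 (w00 w) (Ici 0) r‖ₑ with hN
  have hNle : N ≤ couplingNorm00 s (w00 w) := by
    refine le_trans ?_ le_add_self
    exact Finset.single_le_sum (f := fun ν => ⨆ r ∈ Ici (0 : ℝ),
      ‖iteratedDerivWithin ν (w00 w) (Ici 0) r‖ₑ) (fun _ _ => zero_le)
      (Finset.mem_Icc.2 ⟨le_rfl, hs⟩)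
  have hNtop : N ≠ ⊤ := (hNle.trans_lt hfin.1).ne
  refine ⟨N.toReal, (interactionNorm μ s ξ w).toReal,
    lipschitz_of_norm_derivWithin_le (differentiableOn_w00 hs hw) fun r hr => ?_, ?_⟩
  · have h1 : ‖iteratedDerivWithin 1 (w00 w) (Ici 0) r‖ₑ ≤ N := le_iSup₂_of_le r hr le_rfl
    rw [iteratedDerivWithin_one] at h1
    rw [← toReal_enorm]
    exact ENNReal.toReal_mono hNtop h1
  · rw [ENNReal.ofReal_toReal hfin.2.ne]

/-- Here the constants come from the polydisc alone, as uniformity in the parameter requires: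
$|w_{0,0}'|\le 1+|w_{0,0}'-1|\le 1+\beta$. -/
theorem isCouplingBound_of_derivWithin {μ : ℝ} {s : ℕ} (hs : 1 ≤ s) {ξ β γ : ℝ} {w : Coupling}
    (hw : w ∈ couplingSpace μ s ξ)
    (hβ : ∀ r ∈ Ici (0 : ℝ), ‖derivWithin (fun r => w00 w r - w00 w 0) (Ici 0) r - 1‖ ≤ β)
    (hγ : interactionNorm μ s ξ w ≤ ENNReal.ofReal γ) :
    IsCouplingBound μ s ξ (1 + β) γ w := by
  refine ⟨lipschitz_of_norm_derivWithin_le (differentiableOn_w00 hs hw) fun r hr => ?_, hγ⟩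
  have h := hβ r hr
  rw [derivWithin_sub_const] at h
  have h2 := norm_le_norm_add_norm_sub' (derivWithin (w00 w) (Ici 0) r) 1
  rw [norm_one] at h2
  linarith

/-! ### Analytic dependence on the parameter -/

theorem analyticAt_clm_comp {E F G : Type*} [NormedAddCommGroup E] [NormedSpace ℂ E]
    [NormedAddCommGroup F] [NormedSpace ℂ F] [NormedAddCommGroup G] [NormedSpace ℂ G]
    (A : F →L[ℂ] G) {f : E → F} {x : E} (hf : AnalyticAt ℂ f x) :
    AnalyticAt ℂ (fun y => A (f y)) x :=
  (A.analyticAt _).comp hf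

theorem analyticAt_boundedFieldFun {f : ℂ → BoundedContinuousFunction ℝ ℂ} {z : ℂ}
    (hf : AnalyticAt ℂ f z) : AnalyticAt ℂ (fun τ => boundedFieldFun (f τ)) z :=
  analyticAt_clm_comp (F := BoundedContinuousFunction ℝ ℂ) (G := Fock →L[ℂ] Fock)
    boundedFieldFun hf

theorem analyticAt_comp_right {E F : Type*} [NormedAddCommGroup E] [NormedSpace ℂ E]
    [NormedAddCommGroup F] [NormedSpace ℂ F] (A : F →L[ℂ] F) {f : E → F →L[ℂ] F} {x : E}
    (hf : AnalyticAt ℂ f x) : AnalyticAt ℂ (fun y => f y ∘L A) x :=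
  analyticAt_clm_comp ((ContinuousLinearMap.compL ℂ F F F).flip A) hf

-- `LineAnalyticOn` speaks only of $\tau=0$; differentiability at $\tau_0$ follows by moving the
-- base point to $x+\tau_0v$.
open Filter Topology in
theorem LineAnalyticOn.differentiableOn_line {X Y : Type*} [NormedAddCommGroup X]
    [NormedSpace ℂ X] [NormedAddCommGroup Y] [NormedSpace ℂ Y] {f : X → Y} {S : Set X}
    (hf : LineAnalyticOn f S) (x v : X) :
    DifferentiableOn ℂ (fun τ : ℂ => f (x + τ • v)) {τ | x + τ • v ∈ S} := by
  intro τ₀ hτ₀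
  have h1 := (hf _ hτ₀ v).differentiableAt
  have h2 : DifferentiableAt ℂ (fun τ : ℂ => f (x + τ₀ • v + (τ - τ₀) • v)) τ₀ :=
    DifferentiableAt.comp τ₀ (g := fun τ : ℂ => f (x + τ₀ • v + τ • v)) (f := fun τ => τ - τ₀)
      (by simpa using h1) (by fun_prop)
  refine DifferentiableAt.differentiableWithinAt ?_
  have e : (fun τ : ℂ => f (x + τ • v)) = fun τ => f (x + τ₀ • v + (τ - τ₀) • v) := by
    funext τ
    rw [sub_smul, add_assoc, add_sub_cancel]
  rw [e]
  exact h2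

open Filter Topology in
/-- If `w_{0,0}` is a uniform limit of averages of a holomorphic family of operators, then
`w_{0,0}(r)` is holomorphic for every `r ≥ 0`. -/
theorem differentiableOn_w00_of_ballAverage {L γ : ℝ} {U : Set ℂ} (hU : IsOpen U)
    {w : ℂ → Coupling} {B : ℂ → Fock →L[ℂ] Fock}
    (hL : ∀ τ ∈ U, ∀ a b : ℝ, 0 ≤ a → 0 ≤ b → ‖w00 (w τ) a - w00 (w τ) b‖ ≤ L * |a - b|)
    (hw : ∀ τ ∈ U, ∀ k₀ : E3, 0 < ‖k₀‖ → ∀ ε, 0 < ε → ε ≤ ‖k₀‖ / 2 →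
      ‖ballAverage k₀ ε (B τ) - w00 (w τ) ‖k₀‖‖ ≤
        |L| * ε + 2 / ‖k₀‖ * max γ 0 * ballVolume ε)
    (hB : DifferentiableOn ℂ B U) (r : ℝ) (hr : 0 ≤ r) :
    DifferentiableOn ℂ (fun τ => w00 (w τ) r) U := by
  have hlim : ∀ {F : ℝ → ℂ → ℂ} {f : ℂ → ℂ} {b : ℝ → ℝ}, Tendsto b (𝓝[>] 0) (𝓝 0) →
      (∀ᶠ ε in 𝓝[>] 0, DifferentiableOn ℂ (F ε) U) →
      (∀ᶠ ε in 𝓝[>] 0, ∀ τ ∈ U, ‖F ε τ - f τ‖ ≤ b ε) → DifferentiableOn ℂ f U := by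
    intro F f b hb hF hFf
    refine TendstoLocallyUniformlyOn.differentiableOn (φ := 𝓝[>] (0 : ℝ)) (F := F)
      (TendstoUniformlyOn.tendstoLocallyUniformlyOn ?_) hF hU
    rw [Metric.tendstoUniformlyOn_iff]
    intro δ hδ
    filter_upwards [hFf, hb.eventually (gt_mem_nhds hδ)] with ε h1 h2 τ hτ
    rw [dist_comm, dist_eq_norm]
    exact (h1 τ hτ).trans_lt h2
  have hpos : ∀ r : ℝ, 0 < r → DifferentiableOn ℂ (fun τ => w00 (w τ) r) U := by
    intro r hr
    obtain ⟨k₀, rfl⟩ := exists_norm_eq r hr.le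
    refine hlim (F := fun ε τ => ballAverage k₀ ε (B τ)) (tendsto_averageError L γ ‖k₀‖)
      (.of_forall fun ε => (ballAverage k₀ ε).differentiable.comp_differentiableOn hB) ?_
    filter_upwards [Ioc_mem_nhdsGT (half_pos hr)] with ε hε τ hτ
    exact hw τ hτ k₀ hr ε hε.1 hε.2
  -- The averages need $k_0\ne 0$. At $r=0$ the Lipschitz bound makes $w_{0,0}(\varepsilon)\to
  -- w_{0,0}(0)$ uniformly in $\tau$.
  rcases hr.eq_or_lt with rfl | hr
  · refine hlim (F := fun ε τ => w00 (w τ) ε) (b := fun ε => L * |ε - 0|) ?_ ?_ ?_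
    · have : Continuous fun ε : ℝ => L * |ε - 0| := by fun_prop
      exact (this.tendsto' 0 0 (by simp)).mono_left nhdsWithin_le_nhds
    · filter_upwards [self_mem_nhdsWithin] with ε hε using hpos ε hε
    · filter_upwards [self_mem_nhdsWithin] with ε hε τ hτ
      exact hL τ hτ ε 0 (le_of_lt hε) le_rfl
  · exact hpos r hr

theorem LineAnalyticOn.sub {X Y : Type*} [NormedAddCommGroup X] [NormedSpace ℂ X]
    [NormedAddCommGroup Y] [NormedSpace ℂ Y] {f g : X → Y} {S : Set X}
    (hf : LineAnalyticOn f S) (hg : LineAnalyticOn g S) :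
    LineAnalyticOn (fun x => f x - g x) S :=
  fun x hx v => (hf x hx v).sub (hg x hx v)

theorem LineAnalyticOn.comp_right {X F : Type*} [NormedAddCommGroup X] [NormedSpace ℂ X]
    [NormedAddCommGroup F] [NormedSpace ℂ F] {f : X → F →L[ℂ] F} {S : Set X}
    (hf : LineAnalyticOn f S) (A : F →L[ℂ] F) : LineAnalyticOn (fun x => f x ∘L A) S :=
  fun x hx v => analyticAt_comp_right A (hf x hx v)

theorem LineAnalyticOn.congr {X Y : Type*} [NormedAddCommGroup X] [NormedSpace ℂ X]
    [NormedAddCommGroup Y] [NormedSpace ℂ Y] {f g : X → Y} {S : Set X} (hS : IsOpen S)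
    (hf : LineAnalyticOn f S) (h : EqOn f g S) : LineAnalyticOn g S := fun x hx v => by
  refine (hf x hx v).congr ?_
  have hU : IsOpen {τ : ℂ | x + τ • v ∈ S} := hS.preimage (by fun_prop)
  filter_upwards [hU.mem_nhds (show (0 : ℂ) ∈ _ by simpa using hx)] with τ hτ using h hτ

/-- If `H(w)` and `w_{0,0}(H_f) (H_f + 1)⁻¹` depend analytically on a parameter, then so does
`W(w)`. -/
theorem analyticOn_of_freeQuotient {χ : ℝ → ℝ} (hχ : IsCutoff χ) {μ : ℝ} {s : ℕ} {ξ : ℝ}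
    {X : Type*} [NormedAddCommGroup X] [NormedSpace ℂ X] {S : Set X} (hS : IsOpen S)
    {w : X → Coupling} (hbound : ∀ x ∈ S, ∃ L γ, IsCouplingBound μ s ξ L γ (w x))
    {B : X → Fock →L[ℂ] Fock} (hB : ∀ x ∈ S, IsFieldBounded (hamiltonian χ (w x)) (B x))
    (hBan : LineAnalyticOn B S)
    (hfree : LineAnalyticOn (fun x => boundedFieldFun (freeQuotient (w x))) S) :
    FieldAnalyticOn (fun x => fieldFun (w00 (w x))) S ∧
      FieldAnalyticOn (fun x => toUnbounded (interaction χ (w x))) S ∧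
      LineAnalyticOn (fun x => interaction χ (w x)) S := by
  have hdiff := hBan.sub hfree
  have h1 : ∀ x ∈ S, IsFieldBounded (fieldFun (w00 (w x)))
      (boundedFieldFun (freeQuotient (w x))) := fun x hx =>
    (hbound x hx).elim fun _ h => h.elim fun _ h => h.isFieldBounded_fieldFun
  have h2 : ∀ x ∈ S, IsFieldBounded (toUnbounded (interaction χ (w x)))
      (B x - boundedFieldFun (freeQuotient (w x))) := fun x hx =>
    (hbound x hx).elim fun _ h => h.elim fun _ h => h.isFieldBounded_interaction (hB x hx)
  have h3 : ∀ x ∈ S, interaction χ (w x) = (B x - boundedFieldFun (freeQuotient (w x))) ∘L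
      (boundedFieldFun energyMulCutoff + boundedFieldFun energyCutoff) := fun x hx =>
    (hbound x hx).elim fun _ h => h.elim fun _ h => h.interaction_eq hχ (hB x hx)
  exact ⟨⟨_, h1, hfree⟩, ⟨_, h2, hdiff⟩,
    (hdiff.comp_right (boundedFieldFun energyMulCutoff + boundedFieldFun energyCutoff)).congr hS
      fun x hx => (h3 x hx).symm⟩

end SpectralRG

end

/-! ### The proposition -/

theorem mainTheorem6 (χ : ℝ → ℝ) (hχ : SpectralRG.IsCutoff χ)
    (μ : ℝ) (hμ : 0 ≤ μ) (s : ℕ) (hs : 1 ≤ s) (ξ : ℝ) (hξ0 : 0 < ξ) (hξ1 : ξ < 1) (α β γ : ℝ)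
    {X : Type*} [NormedAddCommGroup X] [NormedSpace ℂ X] [CompleteSpace X]
    (S : Set X) (hS : IsOpen S) (w : X → SpectralRG.Coupling)
    (hw : ∀ x ∈ S, w x ∈ SpectralRG.couplingSpace μ s ξ)
    (hanalytic : SpectralRG.FieldAnalyticOn (fun x => SpectralRG.hamiltonian χ (w x)) S)
    (hpolydisc : ∀ x ∈ S,
      SpectralRG.hamiltonian χ (w x) ∈ SpectralRG.polydisc χ μ s ξ α β γ) :
    SpectralRG.FieldAnalyticOn (fun x => SpectralRG.fieldFun (SpectralRG.w00 (w x))) S ∧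
    SpectralRG.FieldAnalyticOn
      (fun x => SpectralRG.toUnbounded (SpectralRG.interaction χ (w x))) S ∧
    SpectralRG.LineAnalyticOn (fun x => SpectralRG.interaction χ (w x)) S := by
  open SpectralRG in
  obtain ⟨B, hB, hBan⟩ := hanalytic
  have hbound : ∀ x ∈ S, ∃ L γ, IsCouplingBound μ s ξ L γ (w x) :=
    fun x hx => exists_isCouplingBound hs (hw x hx)
  -- Membership in the polydisc concerns the operator, so the bounds hold for some $w'$ with
  -- $H(w')=H(w)$, possibly different from $w$. Since the operator determines $w_{0,0}$, the bounds
  -- on $w'_{0,0}$ pass to $w_{0,0}$.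
  have hpoly : ∀ x ∈ S, ∃ w', IsFieldBounded (hamiltonian χ w') (B x) ∧
      IsCouplingBound μ s ξ (1 + β) γ w' ∧ ‖w00 w' 0‖ ≤ α ∧
      EqOn (w00 (w x)) (w00 w') (Ici 0) := by
    intro x hx
    obtain ⟨w', ⟨h1, h2, h3, h4⟩, h5⟩ := hpolydisc x hx
    have hb := isCouplingBound_of_derivWithin hs h1 h3 h4
    have hB' : IsFieldBounded (hamiltonian χ w') (B x) := h5 ▸ hB x hx
    obtain ⟨L, γ', hb'⟩ := hbound x hx
    exact ⟨w', hB', hb, h2, w00_eq_of_hamiltonian_eq hχ hμ hξ0 hξ1 hb' hb (hB x hx) hB'⟩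
  have hL : ∀ x ∈ S, ∀ a b : ℝ, 0 ≤ a → 0 ≤ b →
      ‖w00 (w x) a - w00 (w x) b‖ ≤ (1 + β) * |a - b| := by
    intro x hx a b ha hb
    obtain ⟨w', -, h, -, e⟩ := hpoly x hx
    rw [e ha, e hb]
    exact h.lipschitz a b ha hb
  have hα : ∀ x ∈ S, ‖w00 (w x) 0‖ ≤ α := by
    intro x hx
    obtain ⟨w', -, -, h, e⟩ := hpoly x hx
    rwa [e (mem_Ici.2 le_rfl)]
  have hQnorm : ∀ x ∈ S, ‖freeQuotient (w x)‖ ≤ α + |1 + β| := by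
    intro x hx
    obtain ⟨_, γ', h⟩ := hbound x hx
    have h' : IsCouplingBound μ s ξ (1 + β) γ' (w x) := ⟨hL x hx, h.interaction_le⟩
    exact h'.norm_freeQuotient_le.trans (add_le_add_left (hα x hx) _)
  have hQ : LineAnalyticOn (fun x => freeQuotient (w x)) S := by
    intro x hx v
    set U : Set ℂ := {τ | x + τ • v ∈ S} with hU
    have hUo : IsOpen U := hS.preimage (by fun_prop)
    -- Point evaluations are norming for the sup norm.
    refine analyticAt_of_norming (fun t : ℝ => BoundedContinuousFunction.evalCLM ℂ t)
      (fun t y => y.norm_coe_le_norm t)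
      (fun y C hC h => (BoundedContinuousFunction.norm_le hC).2 h) hUo
      (fun τ hτ => hQnorm _ hτ) (fun t => ?_) (show (0 : ℂ) ∈ U by simpa [hU] using hx)
    have hd := differentiableOn_w00_of_ballAverage (γ := γ) hUo
      (w := fun τ => w (x + τ • v)) (B := fun τ => B (x + τ • v)) (fun τ hτ => hL _ hτ)
      -- The average is compared with $w'$, whose interaction norm is bounded by $\gamma$ uniformly
      -- in $\tau$; for $w$ itself only a parameter-dependent bound is known.
      (fun τ hτ k₀ hk₀ ε hε0 hε => by
        obtain ⟨w', h1, h2, -, e⟩ := hpoly _ hτ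
        rw [e (norm_nonneg k₀)]
        exact norm_ballAverage_sub_le hχ hμ hξ0 hξ1 h2 h1 hε0 hk₀ hε)
      (hBan.differentiableOn_line x v) (max t 0) (le_max_right _ _)
    refine (hd.div_const ((1 + max t 0 : ℝ) : ℂ)).congr fun τ hτ => ?_
    obtain ⟨_, _, h⟩ := hbound _ hτ
    exact h.freeQuotient_apply t
  have hfree : LineAnalyticOn (fun x => boundedFieldFun (freeQuotient (w x))) S :=
    fun x hx v => analyticAt_boundedFieldFun (hQ x hx v)
  exact analyticOn_of_freeQuotient hχ hS hbound hB hBan hfree
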